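/- Let $L\ge 1$, fix $\gamma,\mu_1,\dots,\mu_L\in\mathbb{C}$, and put $$a(x)=\sinh(x+\gamma),\qquad b(x)=\sinh x,\qquad c(x)=\sinh\gamma .$$ **The elliptic model.** For $0<p<1$ let $[x]=\frac12\sum_{n\in\mathbb{Z}}(-1)^{n-\frac12}p^{(n+\frac12)^2}e^{-(2n+1)x}$ (with $(-1)^{n-\frac12}=e^{i\pi(n-\frac12)}$) and, in the basis $v_1\otimes v_1,v_1\otimes v_2,v_2\otimes v_1,v_2\otimes v_2$ of $\mathbb{C}^2\otimes\mathbb{C}^2$, $$\mathcal{R}(x;\tau)=\begin{pmatrix}a_+&0&0&0\\0&b_+&c_+&0\\0&c_-&b_-&0\\0&0&0&a_-\end{pmatrix},\qquad a_\pm=[x+\gamma],\quad b_\pm=\frac{[\tau\mp\gamma][x]}{[\tau]},\quad c_\pm=\frac{[\tau\mp x][\gamma]}{[\tau]} .$$ Let $h=\mathrm{diag}(1,-1)$ and let $h_k$ be $h$ acting on the $k$-th factor of $(\mathbb{C}^2)^{\otimes L}$. Let $\mathcal{B}(x,\tau)$ be the upper right block, with respect to the auxiliary space $0$, of the ordered product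 $\mathcal{R}_{01}(x-\mu_1;\tau-\gamma\sum_{k>1}h_k)\,\mathcal{R}_{02}(x-\mu_2;\tau-\gamma\sum_{k>2}h_k)\cdots\mathcal{R}_{0L}(x-\mu_L;\tau)$. The domain-wall partition function of the elliptic model is $$Z_{\tau}(x_1,\dots,x_L)=\langle\bar0|\,\mathcal{B}(x_1,\tau+\gamma)\,\mathcal{B}(x_2,\tau+2\gamma)\cdots\mathcal{B}(x_L,\tau+L\gamma)\,|0\rangle,$$ where $|0\rangle=v_1^{\otimes L}$ and $\langle\bar0|$ is the coordinate functional of $v_2^{\otimes L}$. **The six-vertex model.** Let $Z(x_1,\dots,x_L)=\langle\bar0|B(x_1)\cdots B(x_L)|0\rangle$ be the domain-wall partition function of the six-vertex model, obtained in the same way from the matrix with $a_\pm=a$, $b_\pm=b$, $c_\pm=c$ (no $\tau$). **Statement.** Let $x_0,x_1,\dots,x_L\in\mathbb{C}$ satisfy $b(x_i-x_j)\ne0$ for all $0\le i\neq j\le L$ and $a(x_0-\mu_k)\neq0$ for $1\le k\le L$. Write $X=(x_1,\dots,x_L)$, and $X_i^0$ for $X$ with $x_i$ replaced by $x_0$.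 Then: (i) $Z$ is the six-vertex limit of $Z_\tau$: if $\operatorname{Re}\tau$ is large enough, $Z_\tau^{\mathrm{trig}}(X)=\lim_{p\to0^+}(-i\,p^{-1/4})^{L^2}Z_\tau(X)$ exists, and $\lim_{\operatorname{Re}\tau\to+\infty}e^{\sum_{j=1}^L(x_j-\mu_j)}Z_\tau^{\mathrm{trig}}(X)=Z(X)$; (ii) $$Z(X)=\det(V)\prod_{k=1}^L\frac{b(x_k-x_0)}{a(x_0-\mu_k)};$$ (iii) for every $1\le i\le L$, $$Z(X_i^0)=\det(V_i)\prod_{k=1}^L\frac{b(x_k-x_0)}{a(x_0-\mu_k)} .$$ Here $V$ and $V_i$ are the $L\times L$ matrices with entries ($1\le\alpha,\beta\le L$) $$V_{\alpha,\beta}=\begin{cases}\displaystyle\prod_{k=1}^L b(x_\alpha-\mu_k)-\prod_{k=1}^L a(x_\alpha-\mu_k)\prod_{\substack{k=0\\k\ne\alpha}}^L\frac{a(x_k-x_\alpha)}{b(x_k-x_\alpha)}&\beta=\alpha,\\[3ex]\displaystyle\frac{c(x_\beta-x_\alpha)}{b(x_\beta-x_\alpha)}\prod_{k=1}^L a(x_\beta-\mu_k)\prod_{\substack{k=0\\k\ne\alpha,\beta}}^L\frac{a(x_k-x_\beta)}{b(x_k-x_\beta)}&\beta\neq\alpha,\end{cases}$$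 $$(V_i)_{\alpha,\beta}=\begin{cases}\displaystyle\frac{c(x_\alpha-x_0)}{b(x_\alpha-x_0)}\prod_{k=1}^L a(x_0-\mu_k)\prod_{\substack{k=1\\k\ne\alpha}}^L\frac{a(x_k-x_0)}{b(x_k-x_0)}&\beta=i,\\[3ex]V_{\alpha,\beta}&\beta\ne i.\end{cases}$$ In particular $x_0$ is a free parameter in (ii). -/

import Mathlib

open scoped BigOperators Topology

noncomputable section

namespace DomainWall

/-! ### Vertex weights, monodromy matrices and domain-wall partition functions -/

/-- The ice-type `4 × 4` matrix
`((a₁,0,0,0), (0,b₁,c₁,0), (0,c₂,b₂,0), (0,0,0,a₂))` on `ℂ² ⊗ ℂ²` in the ordered basis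
`v₁⊗v₁, v₁⊗v₂, v₂⊗v₁, v₂⊗v₂`. The index `0 : Fin 2` stands for `v₁`, and `1` for `v₂`. -/
def iceMatrix (a₁ b₁ c₁ c₂ b₂ a₂ : ℂ) : Matrix (Fin 2 × Fin 2) (Fin 2 × Fin 2) ℂ :=
  Matrix.of fun u v =>
    match u, v with
    | (0, 0), (0, 0) => a₁
    | (0, 1), (0, 1) => b₁
    | (0, 1), (1, 0) => c₁
    | (1, 0), (0, 1) => c₂
    | (1, 0), (1, 0) => b₂
    | (1, 1), (1, 1) => a₂
    | _, _ => 0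

/-- The weight of a basis vector of `ℂ²` under the Cartan element `H = E₁₁ - E₂₂`. -/
def hWeight (s : Fin 2) : ℂ := if s = 0 then 1 else -1

/-- For an `R`-matrix `R x τ` depending on a spectral parameter and a dynamical parameter, the
operator `R_{0i}(x - μ_i; τ - γ ∑_{k>i} h_k)` on `ℂ² ⊗ (ℂ²)^{⊗L}`. The basis vectors of this space
are indexed by the state of the auxiliary space `0` and the states of the spaces `1, …, L`. -/
def localOp (L : ℕ) (R : ℂ → ℂ → Matrix (Fin 2 × Fin 2) (Fin 2 × Fin 2) ℂ) (γ : ℂ)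
    (μ : Fin L → ℂ) (x τ : ℂ) (i : Fin L) :
    Matrix (Fin 2 × (Fin L → Fin 2)) (Fin 2 × (Fin L → Fin 2)) ℂ :=
  Matrix.of fun u v =>
    if ∀ k, k ≠ i → u.2 k = v.2 k then
      R (x - μ i) (τ - γ * ∑ k ∈ Finset.univ.filter (fun k => i < k), hWeight (v.2 k))
        (u.1, u.2 i) (v.1, v.2 i)
    else 0

/-- The (dynamical) monodromy matrix, the ordered product
`R_{01}(x - μ_1; τ - γ ∑_{k>1} h_k) ⋯ R_{0L}(x - μ_L; τ)`. -/
def monodromy (L : ℕ) (R : ℂ → ℂ → Matrix (Fin 2 × Fin 2) (Fin 2 × Fin 2) ℂ) (γ : ℂ)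
    (μ : Fin L → ℂ) (x τ : ℂ) :
    Matrix (Fin 2 × (Fin L → Fin 2)) (Fin 2 × (Fin L → Fin 2)) ℂ :=
  (List.ofFn fun i => localOp L R γ μ x τ i).prod

/-- The operator `B(x, τ)` on `(ℂ²)^{⊗L}`: the upper right block of the monodromy matrix written as
a `2 × 2` matrix over the auxiliary space. -/
def opB (L : ℕ) (R : ℂ → ℂ → Matrix (Fin 2 × Fin 2) (Fin 2 × Fin 2) ℂ) (γ : ℂ)
    (μ : Fin L → ℂ) (x τ : ℂ) : Matrix (Fin L → Fin 2) (Fin L → Fin 2) ℂ :=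
  Matrix.of fun s t => monodromy L R γ μ x τ (0, s) (1, t)

/-- The domain-wall partition function
`⟨0̄| B(x_1, τ + γ) B(x_2, τ + 2γ) ⋯ B(x_L, τ + Lγ) |0⟩`, where `|0⟩ = v₁ ⊗ ⋯ ⊗ v₁` and
`⟨0̄|` is the coordinate functional of `v₂ ⊗ ⋯ ⊗ v₂`. -/
def partitionFunction (L : ℕ) (R : ℂ → ℂ → Matrix (Fin 2 × Fin 2) (Fin 2 × Fin 2) ℂ) (γ : ℂ)
    (μ : Fin L → ℂ) (x : Fin L → ℂ) (τ : ℂ) : ℂ :=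
  (List.ofFn fun j : Fin L => opB L R γ μ (x j) (τ + ((j : ℕ) + 1) * γ)).prod
    (fun _ => 1) (fun _ => 0)

/-! ### The elliptic SOS model -/

/-- The theta function
`[x] = (1/2) ∑_{n ∈ ℤ} (-1)^{n - 1/2} p^{(n + 1/2)²} e^{-(2n+1)x}` of nome `p`
(with the principal branch `(-1)^{n - 1/2} = e^{iπ(n - 1/2)}`). -/
def theta (p : ℝ) (x : ℂ) : ℂ :=
  (1 / 2) * ∑' n : ℤ, (-1 : ℂ) ^ ((n : ℂ) - 1 / 2) * ((p ^ (((n : ℝ) + 1 / 2) ^ 2) : ℝ) : ℂ) *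
    Complex.exp (-(2 * (n : ℂ) + 1) * x)

/-- The elliptic dynamical `R`-matrix. -/
def ellipticR (p : ℝ) (γ : ℂ) (x τ : ℂ) : Matrix (Fin 2 × Fin 2) (Fin 2 × Fin 2) ℂ :=
  iceMatrix
    (theta p (x + γ))
    (theta p (τ - γ) * theta p x * (theta p τ)⁻¹)
    (theta p (τ - x) * theta p γ * (theta p τ)⁻¹)
    (theta p (τ + x) * theta p γ * (theta p τ)⁻¹)
    (theta p (τ + γ) * theta p x * (theta p τ)⁻¹)
    (theta p (x + γ))

/-- The partition function of the elliptic SOS model with domain-wall boundaries. -/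
def ellipticZ (L : ℕ) (p : ℝ) (γ : ℂ) (μ x : Fin L → ℂ) (τ : ℂ) : ℂ :=
  partitionFunction L (ellipticR p γ) γ μ x τ

/-! ### The six-vertex model -/

/-- The weight `a(x) = sinh (x + γ)`. -/
def wa (γ x : ℂ) : ℂ := Complex.sinh (x + γ)

/-- The weight `b(x) = sinh x`. -/
def wb (x : ℂ) : ℂ := Complex.sinh x

/-- The weight `c(x) = sinh γ`. -/
def wc (γ : ℂ) (_x : ℂ) : ℂ := Complex.sinh γ

/-- The six-vertex `R`-matrix. -/
def sixVertexR (γ x : ℂ) : Matrix (Fin 2 × Fin 2) (Fin 2 × Fin 2) ℂ :=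
  iceMatrix (wa γ x) (wb x) (wc γ x) (wc γ x) (wb x) (wa γ x)

/-- The partition function `Z(x_1, …, x_L)` of the six-vertex model with domain-wall boundaries;
its `R`-matrix has no dynamical parameter, so that the value `0` given for it plays no role. -/
def sixVertexZ (L : ℕ) (γ : ℂ) (μ x : Fin L → ℂ) : ℂ :=
  partitionFunction L (fun x _ => sixVertexR γ x) γ μ x 0

/-! ### The matrices of the determinantal formulae -/

/-- The `L × L` matrix `V`. In `∏_k` with `0 ≤ k ≤ L` the variables are `(x_0, x_1, …, x_L)`, here
`Fin.cons x₀ x`, so that `x_α` is the entry at `α.succ`. -/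
def matV (L : ℕ) (γ : ℂ) (μ x : Fin L → ℂ) (x₀ : ℂ) : Matrix (Fin L) (Fin L) ℂ :=
  let y : Fin (L + 1) → ℂ := Fin.cons x₀ x
  Matrix.of fun α β =>
    if β = α then
      ∏ k, wb (x α - μ k) -
        (∏ k, wa γ (x α - μ k)) *
          ∏ k ∈ Finset.univ.filter (fun k : Fin (L + 1) => k ≠ α.succ),
            wa γ (y k - x α) / wb (y k - x α)
    else
      wc γ (x β - x α) / wb (x β - x α) * (∏ k, wa γ (x β - μ k)) *
        ∏ k ∈ Finset.univ.filter (fun k : Fin (L + 1) => k ≠ α.succ ∧ k ≠ β.succ),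
          wa γ (y k - x β) / wb (y k - x β)

/-- The `L × L` matrix `V_i`: its entries with `β ≠ i` are those of `V`. -/
def matVi (L : ℕ) (γ : ℂ) (μ x : Fin L → ℂ) (x₀ : ℂ) (i : Fin L) : Matrix (Fin L) (Fin L) ℂ :=
  Matrix.of fun α β =>
    if β = i then
      wc γ (x α - x₀) / wb (x α - x₀) * (∏ k, wa γ (x₀ - μ k)) *
        ∏ k ∈ Finset.univ.filter (fun k : Fin L => k ≠ α), wa γ (x k - x₀) / wb (x k - x₀)
    else matV L γ μ x x₀ α β

end DomainWall

end

open scoped BigOperators Topology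

noncomputable section

namespace DomainWall

open Complex Finset Filter

/-! ### Principal-minor expansion and a hyperbolic Cauchy determinant -/

section Determinants

/-! Both determinant formulae rest on one sum over subsets, `subsetSum`. Up to column factors the
off-diagonal part of V is the Cauchy matrix `1 / a(x_α - x_β)`, and the diagonal is adjusted so that
V is `diag(∏ b(x_α - μ_k))` plus a column-scaled Cauchy matrix (`matV_apply`). Expanding the
determinant over sets S of columns gives principal minors, which are again Cauchy determinants.
After multiplication by `∏ b(x_k - x₀)` the result is `subsetSum` (`det_matV_mul_prod`). V_i has the
same shape with one column node `x i` moved to `x₀`, and gives `subsetSum` at the replaced variables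
(`det_matVi_mul_prod`).

It remains to see that `Z(x) ∏ a(w - μ_k)` equals `subsetSum` for every w (`sixVertexZ_mul_vacA`).
This is by induction on the number of sites. As functions of `μ 0`, both sides are trigonometric
polynomials of degree at most n+1 for n+1 sites. They satisfy the same recursion at `μ 0 = x 0` and
`μ 0 = x 0 + γ`. Symmetry in the x's, which for Z comes from Yang–Baxter commutation of the B
operators, transfers the first recursion to every `μ 0 = x i`. That makes n+2 nodes, so the two
sides agree. The argument needs `a(x_i - x_j) ≠ 0`; such conditions on γ hold on a dense set, and
continuity in γ removes them.

For the limit from the elliptic model, `tendsto_theta` reduces the normalised theta function to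
sinh. The limit `Re τ → +∞` gives the non-dynamical matrix `gaugedR`, a diagonal gauge transform of
the six-vertex matrix; by weight conservation the gauge factors telescope and leave exactly the
exponential prefactor (`partitionFunction_gaugedR`). -/

/-- The determinant of the sum of a diagonal matrix and a matrix with rescaled columns, expanded
over the sets of columns taken from the second summand. -/
theorem det_diagonal_add_mul_diagonal {ι : Type*} [Fintype ι] [DecidableEq ι]
    (B C : ι → ℂ) (K : Matrix ι ι ℂ) :
    (Matrix.of fun α β => (if β = α then B β else 0) + C β * K α β).det =
      ∑ σ : ι → Bool, (∏ k, if σ k then C k else B k) *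
        (K.submatrix (fun i : {k // σ k = true} => (i : ι))
          (fun i : {k // σ k = true} => (i : ι))).det := by
  -- Transposition turns columns into rows, so that multilinearity can split each of them into its
  -- two summands, chosen by a Boolean.
  have h1 : (Matrix.of fun α β => (if β = α then B β else 0) + C β * K α β).det =
      Matrix.detRowAlternating.toMultilinearMap (fun i : ι => ∑ b : Bool,
        (fun j : ι => if b then C i * K j i else if i = j then B i else 0)) := by
    rw [← Matrix.det_transpose]
    change _ = Matrix.det _
    congr 1
    ext i j
    simp [Matrix.transpose_apply, add_comm]
  rw [h1, MultilinearMap.map_sum]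
  refine Finset.sum_congr rfl fun σ _ => ?_
  have h2 : Matrix.detRowAlternating.toMultilinearMap (fun i : ι =>
        (fun j : ι => if σ i then C i * K j i else if i = j then B i else 0)) =
      (Matrix.of fun i j => (if σ i then C i else B i) *
        (Matrix.of fun i j => if σ i then K j i else (1 : Matrix ι ι ℂ) i j) i j).det := by
    change Matrix.det _ = _
    congr 1
    ext i j
    rcases eq_or_ne i j with rfl | h' <;> by_cases h : σ i <;> simp [Matrix.one_apply, *]
  rw [h2, Matrix.det_mul_column]
  congr 1
  -- Rows not selected by σ are unit vectors: the matrix is block triangular with an identity block.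
  rw [Matrix.twoBlockTriangular_det _ (fun i => σ i = true)]
  · have h3 : (Matrix.toSquareBlockProp (Matrix.of fun i j =>
        if σ i then K j i else (1 : Matrix ι ι ℂ) i j) fun i => ¬ σ i = true) = 1 := by
      ext i j
      simp only [Matrix.toSquareBlockProp_def, Matrix.of_apply, if_neg i.2, Matrix.one_apply,
        Subtype.ext_iff]
    rw [h3, Matrix.det_one, mul_one, ← Matrix.det_transpose]
    congr 1
    ext i j
    simp [Matrix.toSquareBlockProp_def, Matrix.transpose_apply, j.2]
  · intro i hi j hj
    have : i ≠ j := by rintro rfl; exact hi hj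
    simp [hi, Matrix.one_apply, this]

/-- The numerator of a 2×2 Cauchy minor factorises. This is what keeps the Cauchy shape after one
elimination step. -/
theorem sinh_mul_sinh_sub (u v w t : ℂ) :
    sinh (u - w) * sinh (v - t) - sinh (v - w) * sinh (u - t) =
      sinh (v - u) * sinh (t - w) := by
  simp only [sinh_sub]
  ring

/-- A hyperbolic Cauchy determinant, for two families `x`, `y` such that a shift `z` of `y` is
almost equal to `x`. -/
theorem det_cauchy_fin (γ : ℂ) : ∀ (n : ℕ) (x z : Fin n → ℂ)
    (_ : ∀ i j, sinh (x i - z j + γ) ≠ 0)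
    (_ : ∀ i j, i ≠ j →
      sinh (x i - x j) * sinh (z j - z i) = sinh (x i - z j) * sinh (x j - z i)),
    (Matrix.of fun i j => (sinh (x i - z j + γ))⁻¹).det =
      ∏ i, ∏ j, (if i = j then 1 else sinh (x i - z j)) / sinh (x i - z j + γ) := by
  intro n
  induction n with
  | zero => intro x z _ _; simp
  | succ n ih =>
    intro x z h0 hz
    set M : Matrix (Fin (n + 1)) (Fin (n + 1)) ℂ :=
      Matrix.of fun i j => (sinh (x i - z j + γ))⁻¹ with hM
    set N : Matrix (Fin n) (Fin n) ℂ :=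
      Matrix.of fun i j => (sinh (x i.succ - z j.succ + γ))⁻¹ with hN
    have hih := ih (fun i => x i.succ) (fun i => z i.succ) (fun i j => h0 _ _)
      (fun i j hij => hz _ _ (by simpa using hij))
    -- Row 0 clears the first column; by `hsub` the remaining minor is row factors times column
    -- factors times a smaller Cauchy matrix.
    set M' : Matrix (Fin (n + 1)) (Fin (n + 1)) ℂ := Matrix.of fun i j =>
      M i j - (if i = 0 then 0 else sinh (x 0 - z 0 + γ) / sinh (x i - z 0 + γ)) * M 0 j with hM'
    have hdet : M.det = M'.det := by
      refine Matrix.det_eq_of_forall_row_eq_smul_add_const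
        (fun i => if i = 0 then 0 else sinh (x 0 - z 0 + γ) / sinh (x i - z 0 + γ)) 0 (by simp) ?_
      intro i j
      simp [hM']
    have hcol : ∀ i : Fin n, M' i.succ 0 = 0 := by
      intro i
      have e1 := h0 0 0
      have e2 := h0 i.succ 0
      simp only [hM', hM, Matrix.of_apply, Fin.succ_ne_zero, if_false]
      field_simp
      ring
    have hsub : ∀ i j : Fin n, M' i.succ j.succ =
        (sinh (x 0 - x i.succ) / sinh (x i.succ - z 0 + γ)) *
          ((sinh (z j.succ - z 0) / sinh (x 0 - z j.succ + γ)) * N i j) := by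
      intro i j
      have e1 := h0 i.succ j.succ
      have e2 := h0 i.succ 0
      have e3 := h0 0 j.succ
      have e4 := sinh_mul_sinh_sub (x i.succ) (x 0) (z 0 - γ) (z j.succ - γ)
      rw [sub_sub_sub_cancel_right] at e4
      simp only [← sub_add] at e4
      simp only [hM', hM, hN, Matrix.of_apply, Fin.succ_ne_zero, if_false]
      field_simp
      rw [← e4]
      ring
    rw [hdet, Matrix.det_succ_column_zero, Fin.sum_univ_succ]
    simp only [hcol, mul_zero, zero_mul, Finset.sum_const_zero, add_zero]
    have hminor : (M'.submatrix (Fin.succAbove 0) Fin.succ) = Matrix.of fun i j =>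
        (sinh (x 0 - x i.succ) / sinh (x i.succ - z 0 + γ)) *
          (Matrix.of fun i j =>
            ((sinh (z j.succ - z 0) / sinh (x 0 - z j.succ + γ)) * N i j)) i j := by
      ext i j
      simp only [Matrix.submatrix_apply, Fin.zero_succAbove, Matrix.of_apply, hsub]
    rw [hminor, Matrix.det_mul_column, Matrix.det_mul_row, hih]
    simp only [Fin.prod_univ_succ, Finset.prod_mul_distrib, if_true, Fin.succ_ne_zero, if_false,
      Fin.succ_inj, fun i : Fin n => (Fin.succ_ne_zero i).symm]
    have hM0 : M' 0 0 = (sinh (x 0 - z 0 + γ))⁻¹ := by simp [hM', hM]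
    -- Here `hz` trades the usual Cauchy numerator `sinh (x i - x j) * sinh (z j - z i)` for the
    -- off-diagonal factors `sinh (x i - z j)`.
    have hprod : (∏ i : Fin n, sinh (x 0 - x i.succ) / sinh (x i.succ - z 0 + γ)) *
        (∏ i : Fin n, sinh (z i.succ - z 0) / sinh (x 0 - z i.succ + γ)) =
        (∏ i : Fin n, sinh (x 0 - z i.succ) / sinh (x 0 - z i.succ + γ)) *
        (∏ i : Fin n, sinh (x i.succ - z 0) / sinh (x i.succ - z 0 + γ)) := by
      rw [← Finset.prod_mul_distrib, ← Finset.prod_mul_distrib]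
      refine Finset.prod_congr rfl fun i _ => ?_
      have := hz 0 i.succ (Fin.succ_ne_zero i).symm
      rw [div_mul_div_comm, div_mul_div_comm, this, mul_comm (sinh (x 0 - z i.succ + γ))]
    rw [hM0]
    simp only [Fin.val_zero, pow_zero, one_mul, one_div]
    linear_combination (sinh (x 0 - z 0 + γ))⁻¹ * (∏ i : Fin n, ∏ j : Fin n,
      (if i = j then 1 else sinh (x i.succ - z j.succ)) / sinh (x i.succ - z j.succ + γ)) * hprod

theorem det_cauchy {ι : Type*} [Fintype ι] [DecidableEq ι] (γ : ℂ) (x z : ι → ℂ)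
    (h0 : ∀ i j, sinh (x i - z j + γ) ≠ 0)
    (hz : ∀ i j, i ≠ j →
      sinh (x i - x j) * sinh (z j - z i) = sinh (x i - z j) * sinh (x j - z i)) :
    (Matrix.of fun i j => (sinh (x i - z j + γ))⁻¹).det =
      ∏ i, ∏ j, (if i = j then 1 else sinh (x i - z j)) / sinh (x i - z j + γ) := by
  let e := (Fintype.equivFin ι).symm
  have := det_cauchy_fin γ _ (x ∘ e) (z ∘ e) (fun i j => h0 _ _)
    (fun i j hij => hz _ _ (by simpa using hij))
  rw [← Matrix.det_submatrix_equiv_self e]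
  refine Eq.trans ?_ (this.trans ?_)
  · rfl
  · rw [← e.prod_comp]
    refine Finset.prod_congr rfl fun i _ => ?_
    rw [← e.prod_comp]
    refine Finset.prod_congr rfl fun j _ => ?_
    simp

end Determinants

/-! ### The determinants of V and V_i as sums over subsets -/

section SubsetSum

/-- The eigenvalue `∏ a(u - μ_m)` of the diagonal monodromy entries on the reference states. -/
def vacA {m : ℕ} (γ : ℂ) (μ : Fin m → ℂ) (u : ℂ) : ℂ := ∏ k, wa γ (u - μ k)

/-- The eigenvalue `∏ b(u - μ_m)` of the diagonal monodromy entries on the reference states. -/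
def vacD {m : ℕ} (μ : Fin m → ℂ) (u : ℂ) : ℂ := ∏ k, wb (u - μ k)

/-- One term of `subsetSum`: the subset of `Fin n` is given by its characteristic function. -/
def subsetTerm {n m : ℕ} (γ : ℂ) (μ : Fin m → ℂ) (x : Fin n → ℂ) (w : ℂ) (σ : Fin n → Bool) : ℂ :=
  ∏ j, if σ j then vacA γ μ (x j) * wa γ (w - x j) *
      ∏ k, (if σ k then 1 else wa γ (x k - x j) / wb (x k - x j))
    else vacD μ (x j) * wb (x j - w)

/-- The sum over subsets `S` of the products of `∏_{j ∈ S} a(w - x_j) ∏_m a(x_j - μ_m)`,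
`∏_{k ∉ S} b(x_k - w) ∏_m b(x_k - μ_m)` and `∏_{j ∈ S, k ∉ S} a(x_k - x_j) / b(x_k - x_j)`. -/
def subsetSum {n m : ℕ} (γ : ℂ) (μ : Fin m → ℂ) (x : Fin n → ℂ) (w : ℂ) : ℂ :=
  ∑ σ : Fin n → Bool, subsetTerm γ μ x w σ

theorem prod_subtype_bool {ι : Type*} [Fintype ι] (σ : ι → Bool) (f : ι → ℂ) :
    ∏ i : {k // σ k = true}, f i = ∏ i, if σ i then f i else 1 := by
  classical
  rw [← Finset.prod_filter]
  exact (Finset.prod_subtype _ (by simp) f).symm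

/-- Principal minors of a Cauchy matrix are Cauchy. Two node families are kept so that V (`z = x`)
and V_i (`z` changed at one index) are both covered. -/
theorem det_diagonal_add_cauchy {L : ℕ} (γ : ℂ) (x z B C : Fin L → ℂ)
    (h0 : ∀ i j, wa γ (x i - z j) ≠ 0)
    (hz : ∀ i j, i ≠ j → wb (x i - x j) * wb (z j - z i) = wb (x i - z j) * wb (x j - z i)) :
    (Matrix.of fun α β => (if β = α then B β else 0) + C β * (wa γ (x α - z β))⁻¹).det =
      ∑ σ : Fin L → Bool, ∏ j, if σ j then
        C j * ∏ i, (if σ i then (if i = j then 1 else wb (x i - z j)) / wa γ (x i - z j) else 1)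
        else B j := by
  have := det_diagonal_add_mul_diagonal B C (Matrix.of fun α β => (wa γ (x α - z β))⁻¹)
  simp only [Matrix.of_apply] at this
  rw [this]
  refine Finset.sum_congr rfl fun σ _ => ?_
  have h1 := det_cauchy γ (fun i : {k // σ k = true} => x i) (fun i : {k // σ k = true} => z i)
    (fun i j => h0 i j) (fun i j hij => hz i j (by simpa [Subtype.ext_iff] using hij))
  have h2 : (Matrix.submatrix (Matrix.of fun α β => (wa γ (x α - z β))⁻¹)
      (fun i : {k // σ k = true} => (i : Fin L)) (fun i : {k // σ k = true} => (i : Fin L))) =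
      Matrix.of fun i j : {k // σ k = true} => (sinh (x i - z j + γ))⁻¹ := rfl
  rw [h2, h1, Finset.prod_comm]
  have h3 : ∀ j : {k // σ k = true}, (∏ i : {k // σ k = true},
      (if i = j then 1 else sinh (x i - z j)) / sinh (x i - z j + γ)) =
      ∏ i, (if σ i then (if i = (j : Fin L) then 1 else wb (x i - z j)) / wa γ (x i - z j)
        else 1) := by
    intro j
    rw [← prod_subtype_bool]
    refine Finset.prod_congr rfl fun i _ => ?_
    simp [Subtype.ext_iff, wb, wa]
  simp only [h3]
  rw [prod_subtype_bool σ (fun j => ∏ i, (if σ i then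
    (if i = j then 1 else wb (x i - z j)) / wa γ (x i - z j) else 1)), ← Finset.prod_mul_distrib]
  refine Finset.prod_congr rfl fun j _ => ?_
  split_ifs <;> simp

theorem prod_filter_ne_cons {L : ℕ} (x : Fin L → ℂ) (x₀ : ℂ) (β : Fin L) (f : ℂ → ℂ) :
    ∏ k ∈ Finset.univ.filter (fun k : Fin (L + 1) => k ≠ β.succ),
      f ((Fin.cons x₀ x : Fin (L + 1) → ℂ) k) = f x₀ * ∏ k, if k = β then 1 else f (x k) := by
  rw [Finset.prod_filter, Fin.prod_univ_succ]
  simp [(Fin.succ_ne_zero β).symm]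

/-- The coefficients `c_β` in `V = diag(B) + (c_β / a(x_α - x_β))`. -/
def cauchyCoeff {L : ℕ} (γ : ℂ) (μ x : Fin L → ℂ) (x₀ : ℂ) (β : Fin L) : ℂ :=
  -(sinh γ * vacA γ μ (x β) * (wa γ (x₀ - x β) / wb (x₀ - x β) *
    ∏ k, if k = β then 1 else wa γ (x k - x β) / wb (x k - x β)))

theorem wb_sub_comm (u v : ℂ) : wb (u - v) = -wb (v - u) := by
  rw [wb, wb, ← sinh_neg, neg_sub]

/-- Off the diagonal, reinserting the missing factor k = α of the product cancels `b(x_β - x_α)` up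
to sign and leaves `1 / a(x_α - x_β)`. On the diagonal, `a(0) = sinh γ` cancels the same factor in
`cauchyCoeff`. -/
theorem matV_apply {L : ℕ} (γ : ℂ) (μ x : Fin L → ℂ) (x₀ : ℂ) (hγ : sinh γ ≠ 0)
    (ha : ∀ i j, wa γ (x i - x j) ≠ 0) (α β : Fin L) :
    matV L γ μ x x₀ α β = (if β = α then vacD μ (x β) else 0) +
      cauchyCoeff γ μ x x₀ β * (wa γ (x α - x β))⁻¹ := by
  have h := prod_filter_ne_cons x x₀ β (fun u => wa γ (u - x β) / wb (u - x β))
  rw [cauchyCoeff, ← h]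
  simp only [matV, Matrix.of_apply]
  split_ifs with hαβ
  · subst hαβ
    have : wa γ (x β - x β) = sinh γ := by simp [wa]
    rw [this]
    simp only [vacA, vacD]
    field_simp
    ring
  · have h1 := Finset.mul_prod_erase
      (Finset.univ.filter (fun k : Fin (L + 1) => k ≠ β.succ))
      (fun k => wa γ ((Fin.cons x₀ x : Fin (L + 1) → ℂ) k - x β) /
        wb ((Fin.cons x₀ x : Fin (L + 1) → ℂ) k - x β)) (a := α.succ)
      (by simpa using fun h => hαβ h.symm)
    have h2 : (Finset.univ.filter (fun k : Fin (L + 1) => k ≠ β.succ)).erase α.succ =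
        Finset.univ.filter (fun k : Fin (L + 1) => k ≠ α.succ ∧ k ≠ β.succ) := by
      ext k; simp
    rw [← h1, h2]
    simp only [Fin.cons_succ, vacA, wc]
    rw [wb_sub_comm (x β) (x α), zero_add, div_neg]
    have := ha α β
    generalize (∏ k ∈ Finset.univ.filter (fun k : Fin (L + 1) => k ≠ α.succ ∧ k ≠ β.succ),
      wa γ ((Fin.cons x₀ x : Fin (L + 1) → ℂ) k - x β) /
        wb ((Fin.cons x₀ x : Fin (L + 1) → ℂ) k - x β)) = P
    rw [div_eq_mul_inv, div_eq_mul_inv]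
    linear_combination (sinh γ * (wb (x α - x β))⁻¹ * (∏ k, wa γ (x β - μ k)) * P) *
      (mul_inv_cancel₀ this)

/-- The column identity matching the Cauchy expansion of `det V` with `subsetTerm`. -/
theorem cauchyCoeff_mul_prod {L : ℕ} (γ : ℂ) (μ x : Fin L → ℂ) (x₀ : ℂ) (hγ : sinh γ ≠ 0)
    (hx : ∀ i j, i ≠ j → wb (x i - x j) ≠ 0) (hx₀ : ∀ i, wb (x i - x₀) ≠ 0)
    (ha : ∀ i j, wa γ (x i - x j) ≠ 0) (σ : Fin L → Bool) (j : Fin L) (hj : σ j = true) :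
    cauchyCoeff γ μ x x₀ j *
        (∏ i, (if σ i then (if i = j then 1 else wb (x i - x j)) / wa γ (x i - x j) else 1)) *
        wb (x j - x₀) =
      vacA γ μ (x j) * wa γ (x₀ - x j) *
        ∏ k, (if σ k then 1 else wa γ (x k - x j) / wb (x k - x j)) := by
  have h1 : (∏ k, if k = j then 1 else wa γ (x k - x j) / wb (x k - x j)) *
      (∏ i, (if σ i then (if i = j then 1 else wb (x i - x j)) / wa γ (x i - x j) else 1)) =
      (sinh γ)⁻¹ * ∏ k, (if σ k then 1 else wa γ (x k - x j) / wb (x k - x j)) := by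
    -- The factor `1 / sinh γ` comes from k = j, where `a(0) = sinh γ`; written as a product it
    -- allows a factorwise comparison.
    have h2 : (sinh γ)⁻¹ = ∏ k, if k = j then (sinh γ)⁻¹ else 1 := by simp
    rw [h2, ← Finset.prod_mul_distrib, ← Finset.prod_mul_distrib]
    refine Finset.prod_congr rfl fun k _ => ?_
    rcases eq_or_ne k j with rfl | hkj
    · simp [hj, wa]
    · have := hx k j hkj
      have := ha k j
      by_cases hk : σ k <;> simp [hkj, hk]
      field_simp
  have h3 : wb (x₀ - x j) ≠ 0 := by rw [wb_sub_comm]; exact neg_ne_zero.mpr (hx₀ j)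
  rw [cauchyCoeff, wb_sub_comm (x j)]
  calc _ = (sinh γ * vacA γ μ (x j) * (wa γ (x₀ - x j) / wb (x₀ - x j) * wb (x₀ - x j))) *
        ((∏ k, if k = j then 1 else wa γ (x k - x j) / wb (x k - x j)) *
      (∏ i, (if σ i then (if i = j then 1 else wb (x i - x j)) / wa γ (x i - x j) else 1))) := by
        ring
    _ = _ := by
        rw [h1, div_mul_cancel₀ _ h3]
        field_simp

theorem det_matV_mul_prod {L : ℕ} (γ : ℂ) (μ x : Fin L → ℂ) (x₀ : ℂ) (hγ : sinh γ ≠ 0)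
    (hx : ∀ i j, i ≠ j → wb (x i - x j) ≠ 0) (hx₀ : ∀ i, wb (x i - x₀) ≠ 0)
    (ha : ∀ i j, wa γ (x i - x j) ≠ 0) :
    (matV L γ μ x x₀).det * ∏ k, wb (x k - x₀) = subsetSum γ μ x x₀ := by
  have h : matV L γ μ x x₀ = Matrix.of fun α β => (if β = α then vacD μ (x β) else 0) +
      cauchyCoeff γ μ x x₀ β * (wa γ (x α - x β))⁻¹ := by
    ext α β
    exact matV_apply γ μ x x₀ hγ ha α β
  rw [h, det_diagonal_add_cauchy γ x x _ _ ha (fun i j _ => rfl), Finset.sum_mul, subsetSum]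
  refine Finset.sum_congr rfl fun σ _ => ?_
  rw [← Finset.prod_mul_distrib, subsetTerm]
  refine Finset.prod_congr rfl fun j _ => ?_
  split_ifs with hj
  · exact cauchyCoeff_mul_prod γ μ x x₀ hγ hx hx₀ ha σ j hj
  · rfl

/-- Column `i₀` is proportional to `1 / a(x_α - x₀)`: it is a Cauchy column whose node has moved to
`x₀`, with no diagonal term. -/
theorem det_matVi_mul_prod {L : ℕ} (γ : ℂ) (μ x : Fin L → ℂ) (x₀ : ℂ) (i₀ : Fin L)
    (hγ : sinh γ ≠ 0)
    (hx : ∀ i j, i ≠ j → wb (x i - x j) ≠ 0) (hx₀ : ∀ i, wb (x i - x₀) ≠ 0)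
    (ha : ∀ i j, wa γ (x i - x j) ≠ 0) (ha₀ : ∀ i, wa γ (x i - x₀) ≠ 0) :
    (matVi L γ μ x x₀ i₀).det * ∏ k, wb (x k - x₀) =
      subsetSum γ μ (Function.update x i₀ x₀) x₀ := by
  set z := Function.update x i₀ x₀ with hzdef
  have hz0 : z i₀ = x₀ := by simp [hzdef]
  have hzx : ∀ j, j ≠ i₀ → z j = x j := fun j hj => by simp [hzdef, hj]
  set B : Fin L → ℂ := fun β => if β = i₀ then 0 else vacD μ (x β) with hB
  set C : Fin L → ℂ := fun β => if β = i₀ then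
    sinh γ * vacA γ μ x₀ * ∏ k, wa γ (x k - x₀) / wb (x k - x₀) else cauchyCoeff γ μ x x₀ β with hC
  have h : matVi L γ μ x x₀ i₀ = Matrix.of fun α β => (if β = α then B β else 0) +
      C β * (wa γ (x α - z β))⁻¹ := by
    ext α β
    simp only [matVi, Matrix.of_apply]
    split_ifs with hβ hαβ hαβ
    · subst hβ
      subst hαβ
      have := ha₀ β
      simp only [hB, hC, hz0, if_true, ← Finset.mul_prod_erase _ _ (Finset.mem_univ β), vacA, wc,
        Finset.filter_ne']
      field_simp
      ring
    · subst hβ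
      have := ha₀ α
      simp only [hC, hz0, if_true, ← Finset.mul_prod_erase _ _ (Finset.mem_univ α), vacA, wc,
        Finset.filter_ne']
      field_simp
      ring
    · subst hαβ
      rw [matV_apply γ μ x x₀ hγ ha]
      simp [hB, hC, hβ, hzx]
    · rw [matV_apply γ μ x x₀ hγ ha]
      simp [hC, hβ, hzx, hαβ]
  have haz : ∀ i j, wa γ (x i - z j) ≠ 0 := by
    intro i j
    by_cases hj : j = i₀
    · rw [hj, hz0]; exact ha₀ i
    · rw [hzx j hj]; exact ha i j
  -- The Cauchy condition survives because `z` and `x` differ at a single index.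
  have hzz : ∀ i j, i ≠ j →
      wb (x i - x j) * wb (z j - z i) = wb (x i - z j) * wb (x j - z i) := by
    intro i j hij
    by_cases hi : i = i₀
    · have hj : j ≠ i₀ := fun h => hij (hi.trans h.symm)
      rw [hi, hz0, hzx j hj]
    · by_cases hj : j = i₀
      · rw [hj, hz0, hzx i hi, wb_sub_comm (x i) x₀, wb_sub_comm (x i) (x i₀)]
        ring
      · rw [hzx i hi, hzx j hj]
  rw [h, det_diagonal_add_cauchy γ x z _ _ haz hzz, Finset.sum_mul, subsetSum]
  refine Finset.sum_congr rfl fun σ _ => ?_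
  rw [← Finset.prod_mul_distrib, subsetTerm]
  by_cases hσ : σ i₀ = true
  · have hzσ : ∀ u : ℂ, (∏ k, (if σ k then (1 : ℂ) else wa γ (z k - u) / wb (z k - u))) =
        ∏ k, (if σ k then (1 : ℂ) else wa γ (x k - u) / wb (x k - u)) := by
      intro u
      refine Finset.prod_congr rfl fun k _ => ?_
      by_cases hk : σ k = true
      · simp [hk]
      · rw [hzx k (by rintro rfl; exact hk hσ)]
    refine Finset.prod_congr rfl fun j _ => ?_
    simp only [hzσ]
    by_cases hj : j = i₀
    · subst hj
      have h1 : (∏ k, wa γ (x k - x₀) / wb (x k - x₀)) * (∏ i, (if σ i then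
          (if i = j then 1 else wb (x i - x₀)) / wa γ (x i - x₀) else 1)) =
          (wb (x j - x₀))⁻¹ *
            ∏ k, (if σ k then 1 else wa γ (x k - x₀) / wb (x k - x₀)) := by
        have h2 : (wb (x j - x₀))⁻¹ = ∏ k, if k = j then (wb (x k - x₀))⁻¹ else 1 := by simp
        rw [h2, ← Finset.prod_mul_distrib, ← Finset.prod_mul_distrib]
        refine Finset.prod_congr rfl fun k _ => ?_
        have e1 := hx₀ k
        have e2 := ha₀ k
        rcases eq_or_ne k j with rfl | hkj
        · simp only [hσ, if_true]
          field_simp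
        · by_cases hk : σ k <;> simp [hkj, hk]
          field_simp
      simp only [hσ, if_true, hC, hz0]
      have e1 := hx₀ j
      have e2 : wa γ (x₀ - x₀) = sinh γ := by simp [wa]
      calc _ = sinh γ * vacA γ μ x₀ * wb (x j - x₀) *
            ((∏ k, wa γ (x k - x₀) / wb (x k - x₀)) * (∏ i, (if σ i then
          (if i = j then 1 else wb (x i - x₀)) / wa γ (x i - x₀) else 1))) := by ring
        _ = _ := by
          rw [h1, e2]
          field_simp
    · split_ifs with hσj
      · rw [hzx j hj]
        simp only [hC, if_neg hj]
        exact cauchyCoeff_mul_prod γ μ x x₀ hγ hx hx₀ ha σ j hσj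
      · simp only [hB, if_neg hj, hzx j hj]
  -- Subsets omitting `i₀` contribute zero on both sides: `B i₀ = 0` on the left, `b(x₀ - x₀) = 0`
  -- on the right.
  · rw [Finset.prod_eq_zero (Finset.mem_univ i₀), Finset.prod_eq_zero (Finset.mem_univ i₀)]
    · simp [hσ, hz0, wb]
    · simp [hσ, hB]

end SubsetSum

/-! ### Monodromy matrices site by site and the Yang–Baxter equation -/

section Lattice

theorem sum_fin_succ_fun {n : ℕ} (f : (Fin (n + 1) → Fin 2) → ℂ) :
    ∑ s, f s = ∑ a : Fin 2, ∑ t : Fin n → Fin 2, f (Fin.cons a t) := by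
  rw [← (Fin.consEquiv (fun _ : Fin (n + 1) => Fin 2)).sum_comp, Fintype.sum_prod_type]
  rfl

/-- The blocks of the monodromy matrix for vertex matrices `r i` at the sites, by recursion on the
number of sites. -/
def auxT : (n : ℕ) → (Fin n → Matrix (Fin 2 × Fin 2) (Fin 2 × Fin 2) ℂ) → Fin 2 → Fin 2 →
    Matrix (Fin n → Fin 2) (Fin n → Fin 2) ℂ
  | 0, _, a, b => if a = b then 1 else 0
  | n + 1, r, a, b => Matrix.of fun s t =>
      ∑ e, r 0 (a, s 0) (e, t 0) * auxT n (fun i => r i.succ) e b (Fin.tail s) (Fin.tail t)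

theorem auxT_succ_cons {n : ℕ} (r : Fin (n + 1) → Matrix (Fin 2 × Fin 2) (Fin 2 × Fin 2) ℂ)
    (a b s₀ t₀ : Fin 2) (s t : Fin n → Fin 2) :
    auxT (n + 1) r a b (Fin.cons s₀ s) (Fin.cons t₀ t) =
      ∑ e, r 0 (a, s₀) (e, t₀) * auxT n (fun i => r i.succ) e b s t := by
  simp [auxT]

/-- Operators on the auxiliary space and the last `n` sites, acting as the identity on the
first of `n + 1` sites. -/
def extendFirst (n : ℕ) : Matrix (Fin 2 × (Fin n → Fin 2)) (Fin 2 × (Fin n → Fin 2)) ℂ →*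
    Matrix (Fin 2 × (Fin (n + 1) → Fin 2)) (Fin 2 × (Fin (n + 1) → Fin 2)) ℂ where
  toFun M := Matrix.of fun u v =>
    if u.2 0 = v.2 0 then M (u.1, Fin.tail u.2) (v.1, Fin.tail v.2) else 0
  map_one' := by
    ext ⟨a, s⟩ ⟨b, t⟩
    refine Fin.consCases (fun s₀ s => ?_) s
    refine Fin.consCases (fun t₀ t => ?_) t
    simp only [Matrix.of_apply, Fin.cons_zero, Fin.tail_cons, Matrix.one_apply, Prod.mk.injEq,
      Fin.cons_inj]
    split_ifs <;> tauto
  map_mul' M N := by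
    ext ⟨a, s⟩ ⟨b, t⟩
    refine Fin.consCases (fun s₀ s => ?_) s
    refine Fin.consCases (fun t₀ t => ?_) t
    simp only [Matrix.of_apply, Fin.cons_zero, Fin.tail_cons, Matrix.mul_apply,
      Fintype.sum_prod_type, sum_fin_succ_fun]
    have : ∀ e c : Fin 2, (∑ w : Fin n → Fin 2, (if s₀ = c then M (a, s) (e, w) else 0) *
        (if c = t₀ then N (e, w) (b, t) else 0)) =
        if s₀ = c then (if c = t₀ then ∑ w : Fin n → Fin 2, M (a, s) (e, w) * N (e, w) (b, t)
          else 0) else 0 := by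
      intro e c
      split_ifs <;> simp
    simp only [this, Finset.sum_ite_eq, Finset.mem_univ, if_true]
    split_ifs <;> simp

theorem extendFirst_cons (n : ℕ) (M : Matrix (Fin 2 × (Fin n → Fin 2)) (Fin 2 × (Fin n → Fin 2)) ℂ)
    (a b s₀ t₀ : Fin 2) (s t : Fin n → Fin 2) :
    extendFirst n M (a, Fin.cons s₀ s) (b, Fin.cons t₀ t) =
      if s₀ = t₀ then M (a, s) (b, t) else 0 := by
  simp [extendFirst]

/-- Without a dynamical parameter the operator at a later site ignores the first site; since
`extendFirst` is multiplicative, the first site can then be split off the whole monodromy matrix. -/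
theorem localOp_succ {n : ℕ} (R : ℂ → Matrix (Fin 2 × Fin 2) (Fin 2 × Fin 2) ℂ) (γ : ℂ)
    (μ : Fin (n + 1) → ℂ) (x τ : ℂ) (i : Fin n) :
    localOp (n + 1) (fun x _ => R x) γ μ x τ i.succ =
      extendFirst n (localOp n (fun x _ => R x) γ (fun i => μ i.succ) x τ i) := by
  ext ⟨a, s⟩ ⟨b, t⟩
  refine Fin.consCases (fun s₀ s => ?_) s
  refine Fin.consCases (fun t₀ t => ?_) t
  rw [extendFirst_cons]
  simp only [localOp, Matrix.of_apply, Fin.forall_fin_succ, Fin.cons_zero, Fin.cons_succ,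
    ne_eq, (Fin.succ_ne_zero i).symm, not_false_eq_true, forall_const, Fin.succ_inj]
  by_cases h : s₀ = t₀ <;> simp [h]

/-- For an `R`-matrix without dynamical parameter, the monodromy matrix is given by `auxT`. -/
theorem monodromy_eq_auxT (R : ℂ → Matrix (Fin 2 × Fin 2) (Fin 2 × Fin 2) ℂ) (γ x τ : ℂ) :
    ∀ (n : ℕ) (μ : Fin n → ℂ) (a b : Fin 2) (s t : Fin n → Fin 2),
      monodromy n (fun x _ => R x) γ μ x τ (a, s) (b, t) =
        auxT n (fun i => R (x - μ i)) a b s t := by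
  intro n
  induction n with
  | zero =>
    intro μ a b s t
    simp only [monodromy, List.ofFn_zero, List.prod_nil, auxT, Matrix.one_apply, Prod.mk.injEq,
      Subsingleton.elim s t, and_true]
    split_ifs <;> simp
  | succ n ih =>
    intro μ a b s t
    refine Fin.consCases (fun s₀ s => ?_) s
    refine Fin.consCases (fun t₀ t => ?_) t
    rw [auxT_succ_cons]
    have h1 : monodromy (n + 1) (fun x _ => R x) γ μ x τ =
        localOp (n + 1) (fun x _ => R x) γ μ x τ 0 *
          extendFirst n (monodromy n (fun x _ => R x) γ (fun i => μ i.succ) x τ) := by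
      simp only [monodromy, List.ofFn_succ, List.prod_cons, localOp_succ]
      rw [map_list_prod, List.map_ofFn]
      rfl
    rw [h1, Matrix.mul_apply, Fintype.sum_prod_type]
    refine Finset.sum_congr rfl fun e _ => ?_
    rw [sum_fin_succ_fun, ← ih]
    simp only [extendFirst_cons, localOp, Matrix.of_apply, Fin.forall_fin_succ, Fin.cons_zero,
      Fin.cons_succ, ne_eq, not_true_eq_false, false_imp_iff, true_and, Fin.succ_ne_zero,
      not_false_eq_true, forall_const, mul_ite, mul_zero, Finset.sum_ite_irrel,
      Finset.sum_const_zero]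
    simp only [Finset.sum_ite_eq', Finset.mem_univ, if_true]
    rw [Finset.sum_eq_single s]
    · simp
    · intro w _ hw
      rw [if_neg (fun h => hw (funext fun k => (h k).symm)), zero_mul]
    · simp

theorem auxT_mul_auxT_cons {n : ℕ}
    (r r' : Fin (n + 1) → Matrix (Fin 2 × Fin 2) (Fin 2 × Fin 2) ℂ)
    (a b e f s₀ t₀ : Fin 2) (s t : Fin n → Fin 2) :
    (auxT (n + 1) r a e * auxT (n + 1) r' b f) (Fin.cons s₀ s) (Fin.cons t₀ t) =
      ∑ q, ∑ c, ∑ d, r 0 (a, s₀) (c, q) * r' 0 (b, q) (d, t₀) *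
        (auxT n (fun i => r i.succ) c e * auxT n (fun i => r' i.succ) d f) s t := by
  rw [Matrix.mul_apply, sum_fin_succ_fun]
  refine Finset.sum_congr rfl fun q _ => ?_
  simp only [auxT_succ_cons, Matrix.mul_apply, Fin.sum_univ_two, Finset.mul_sum,
    ← Finset.sum_add_distrib]
  refine Finset.sum_congr rfl fun w _ => ?_
  ring

/-- The Yang-Baxter equation `R₁₂ P₁₃ Q₂₃ = Q₂₃ P₁₃ R₁₂`. -/
def YangBaxter (R P Q : Matrix (Fin 2 × Fin 2) (Fin 2 × Fin 2) ℂ) : Prop :=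
  ∀ a b s e f t, ∑ c, ∑ d, ∑ q, R (a, b) (c, d) * P (c, s) (e, q) * Q (d, q) (f, t) =
    ∑ c, ∑ d, ∑ q, Q (b, s) (d, q) * P (a, q) (c, t) * R (c, d) (e, f)

/-- The Yang-Baxter equation for the monodromy matrices. -/
theorem yangBaxter_auxT (R : Matrix (Fin 2 × Fin 2) (Fin 2 × Fin 2) ℂ) : ∀ (n : ℕ)
    (r r' : Fin n → Matrix (Fin 2 × Fin 2) (Fin 2 × Fin 2) ℂ)
    (_ : ∀ i, YangBaxter R (r i) (r' i)) (a b e f : Fin 2) (s t : Fin n → Fin 2),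
    ∑ c, ∑ d, R (a, b) (c, d) * (auxT n r c e * auxT n r' d f) s t =
      ∑ c, ∑ d, R (c, d) (e, f) * (auxT n r' b d * auxT n r a c) s t := by
  intro n
  induction n with
  | zero =>
    intro r r' _ a b e f s t
    rw [Subsingleton.elim s t]
    simp only [auxT, mul_ite, mul_one, mul_zero]
    fin_cases a <;> fin_cases b <;> fin_cases e <;> fin_cases f <;> simp
  | succ n ih =>
    intro r r' h a b e f s t
    refine Fin.consCases (fun s₀ s => ?_) s
    refine Fin.consCases (fun t₀ t => ?_) t
    have hih := ih (fun i => r i.succ) (fun i => r' i.succ) (fun i => h i.succ)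
    have h0 := h 0 a b s₀
    simp only [auxT_mul_auxT_cons]
    simp only [Fin.sum_univ_two] at hih h0 ⊢
    set P := fun c d => (auxT n (fun i => r i.succ) c e * auxT n (fun i => r' i.succ) d f) s t
      with hP
    -- The `h0` terms move R through the first site, and the `hih` terms move it through the
    -- remaining ones.
    linear_combination P 0 0 * h0 0 0 t₀ + P 0 1 * h0 0 1 t₀ + P 1 0 * h0 1 0 t₀ +
      P 1 1 * h0 1 1 t₀ +
      (r' 0 (b, s₀) (0, 0) * r 0 (a, 0) (0, t₀) + r' 0 (b, s₀) (0, 1) * r 0 (a, 1) (0, t₀)) *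
        hih 0 0 e f s t +
      (r' 0 (b, s₀) (1, 0) * r 0 (a, 0) (0, t₀) + r' 0 (b, s₀) (1, 1) * r 0 (a, 1) (0, t₀)) *
        hih 0 1 e f s t +
      (r' 0 (b, s₀) (0, 0) * r 0 (a, 0) (1, t₀) + r' 0 (b, s₀) (0, 1) * r 0 (a, 1) (1, t₀)) *
        hih 1 0 e f s t +
      (r' 0 (b, s₀) (1, 0) * r 0 (a, 0) (1, t₀) + r' 0 (b, s₀) (1, 1) * r 0 (a, 1) (1, t₀)) *
        hih 1 1 e f s t

theorem iceMatrix_entries (a₁ b₁ c₁ c₂ b₂ a₂ : ℂ) :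
    let M := iceMatrix a₁ b₁ c₁ c₂ b₂ a₂
    M (0, 0) (0, 0) = a₁ ∧
    M (0, 0) (0, 1) = 0 ∧
    M (0, 0) (1, 0) = 0 ∧
    M (0, 0) (1, 1) = 0 ∧
    M (0, 1) (0, 0) = 0 ∧
    M (0, 1) (0, 1) = b₁ ∧
    M (0, 1) (1, 0) = c₁ ∧
    M (0, 1) (1, 1) = 0 ∧
    M (1, 0) (0, 0) = 0 ∧
    M (1, 0) (0, 1) = c₂ ∧
    M (1, 0) (1, 0) = b₂ ∧
    M (1, 0) (1, 1) = 0 ∧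
    M (1, 1) (0, 0) = 0 ∧
    M (1, 1) (0, 1) = 0 ∧
    M (1, 1) (1, 0) = 0 ∧
    M (1, 1) (1, 1) = a₂ :=
  ⟨rfl, rfl, rfl, rfl, rfl, rfl, rfl, rfl, rfl, rfl, rfl, rfl, rfl, rfl, rfl, rfl⟩

-- For ice-type weights symmetric under exchanging the two states, each component is trivial or, up
-- to sign, one of the three given relations.
set_option maxHeartbeats 1000000 in
theorem yangBaxter_ice (a b c a' b' c' a'' b'' c'' : ℂ)
    (h₁ : a * c' * a'' = b * c' * b'' + c * a' * c'')
    (h₂ : a * b' * c'' = b * a' * c'' + c * c' * b'')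
    (h₃ : c * b' * a'' = c * a' * b'' + b * c' * c'') :
    YangBaxter (iceMatrix a b c c b a) (iceMatrix a' b' c' c' b' a')
      (iceMatrix a'' b'' c'' c'' b'' a'') := by
  have e := iceMatrix_entries a b c c b a
  have e' := iceMatrix_entries a' b' c' c' b' a'
  have e'' := iceMatrix_entries a'' b'' c'' c'' b'' a''
  generalize iceMatrix a b c c b a = R at *
  generalize iceMatrix a' b' c' c' b' a' = P at *
  generalize iceMatrix a'' b'' c'' c'' b'' a'' = Q at *
  simp only [YangBaxter, Fin.forall_fin_two, Fin.sum_univ_two, e, e', e'', mul_zero, zero_mul,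
    add_zero, zero_add]
  and_intros <;>
    first
    | trivial
    | ring1
    | linear_combination h₁
    | linear_combination h₂
    | linear_combination h₃
    | linear_combination -h₁
    | linear_combination -h₂
    | linear_combination -h₃

theorem yangBaxter_sixVertex (γ x y m : ℂ) :
    YangBaxter (sixVertexR γ (x - y)) (sixVertexR γ (x - m)) (sixVertexR γ (y - m)) := by
  have hx : x - m = (x - y) + (y - m) := by ring
  rw [hx]
  generalize x - y = u
  generalize y - m = v
  refine yangBaxter_ice _ _ _ _ _ _ _ _ _ ?_ ?_ ?_ <;> simp only [wa, wb, wc, sinh_add, cosh_add]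
  · linear_combination sinh γ * sinh u * sinh v * cosh_sq γ
  · linear_combination sinh γ ^ 2 * sinh v * cosh_sq u
  · linear_combination sinh γ ^ 2 * sinh u * cosh_sq v

end Lattice

/-! ### Commutation of the B operators and recursions for Z -/

section Creation

/-- The block `(a, b)` of the six-vertex monodromy matrix. -/
def sixT (n : ℕ) (γ : ℂ) (μ : Fin n → ℂ) (x : ℂ) (a b : Fin 2) :
    Matrix (Fin n → Fin 2) (Fin n → Fin 2) ℂ :=
  auxT n (fun i => sixVertexR γ (x - μ i)) a b

/-- The product of the six-vertex operators `B(x)` for `x` in a list. -/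
def prodB (n : ℕ) (γ : ℂ) (μ : Fin n → ℂ) (l : List ℂ) :
    Matrix (Fin n → Fin 2) (Fin n → Fin 2) ℂ :=
  (l.map fun x => sixT n γ μ x 0 1).prod

theorem sixVertexZ_eq_prodB (L : ℕ) (γ : ℂ) (μ x : Fin L → ℂ) :
    sixVertexZ L γ μ x = prodB L γ μ (List.ofFn x) (fun _ => 1) (fun _ => 0) := by
  rw [sixVertexZ, partitionFunction, prodB, List.map_ofFn]
  have h : (fun j : Fin L => opB L (fun x _ => sixVertexR γ x) γ μ (x j)
      (0 + ((j : ℕ) + 1) * γ)) = (fun x => sixT L γ μ x 0 1) ∘ x := by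
    funext j
    ext s t
    exact monodromy_eq_auxT _ _ _ _ _ _ _ _ _ _
  rw [h]

/-- In this component of the Yang–Baxter relation only the corner entries `a(x - y)` of R survive,
and they can be cancelled. -/
theorem sixT_comm (n : ℕ) (γ : ℂ) (μ : Fin n → ℂ) (x y : ℂ) (h : wa γ (x - y) ≠ 0) :
    Commute (sixT n γ μ x 0 1) (sixT n γ μ y 0 1) := by
  ext s t
  have := yangBaxter_auxT (sixVertexR γ (x - y)) n (fun i => sixVertexR γ (x - μ i))
    (fun i => sixVertexR γ (y - μ i)) (fun i => yangBaxter_sixVertex γ x y (μ i)) 0 0 1 1 s t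
  have e := iceMatrix_entries (wa γ (x - y)) (wb (x - y)) (wc γ (x - y)) (wc γ (x - y))
    (wb (x - y)) (wa γ (x - y))
  simp only [Fin.sum_univ_two, sixVertexR] at this
  simp only [e, zero_mul, add_zero, zero_add] at this
  exact mul_left_cancel₀ h this

theorem prodB_perm (n : ℕ) (γ : ℂ) (μ : Fin n → ℂ) {l l' : List ℂ} (h : l.Perm l')
    (hl : l.Pairwise fun x y => wa γ (x - y) ≠ 0) : prodB n γ μ l = prodB n γ μ l' := by
  refine List.Perm.prod_eq' (h.map _) ?_
  rw [List.pairwise_map]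
  exact hl.imp fun {x y} hxy => sixT_comm n γ μ x y hxy

theorem prodB_nil (n : ℕ) (γ : ℂ) (μ : Fin n → ℂ) : prodB n γ μ [] = 1 := rfl

theorem prodB_cons (n : ℕ) (γ : ℂ) (μ : Fin n → ℂ) (x : ℂ) (l : List ℂ) :
    prodB n γ μ (x :: l) = sixT n γ μ x 0 1 * prodB n γ μ l := by
  simp [prodB]

theorem prodB_concat (n : ℕ) (γ : ℂ) (μ : Fin n → ℂ) (x : ℂ) (l : List ℂ) :
    prodB n γ μ (l ++ [x]) = prodB n γ μ l * sixT n γ μ x 0 1 := by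
  simp [prodB]

theorem const_eq_cons {n : ℕ} (a : Fin 2) :
    (fun _ : Fin (n + 1) => a) = Fin.cons a (fun _ => a) := by
  ext i; refine Fin.cases ?_ (fun i => ?_) i <;> simp

/-- The ice rule freezes every vertex: the D block has `⟨0̄|` as a left eigenvector and, in
`sixT_apply_zero`, `|0⟩` as a right eigenvector. -/
theorem sixT_apply_one (γ x : ℂ) : ∀ (n : ℕ) (μ : Fin n → ℂ) (t : Fin n → Fin 2),
    sixT n γ μ x 1 1 (fun _ => 1) t = if t = fun _ => 1 then vacA γ μ x else 0 := by
  intro n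
  induction n with
  | zero => intro μ t; simp [sixT, auxT, vacA, Matrix.one_apply, eq_iff_true_of_subsingleton]
  | succ n ih =>
    intro μ t
    refine Fin.consCases (fun t₀ t => ?_) t
    have hih := ih (fun i => μ i.succ) t
    have e := iceMatrix_entries (wa γ (x - μ 0)) (wb (x - μ 0)) (wc γ (x - μ 0)) (wc γ (x - μ 0))
      (wb (x - μ 0)) (wa γ (x - μ 0))
    rw [sixT] at hih ⊢
    rw [const_eq_cons, auxT_succ_cons]
    simp only [sixVertexR, Fin.sum_univ_two] at hih ⊢
    fin_cases t₀
    · simp only [Fin.zero_eta, e, zero_mul, add_zero, Fin.cons_inj, zero_ne_one, false_and,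
        if_false]
    · simp only [Fin.mk_one, e, zero_mul, zero_add, Fin.cons_inj, true_and, hih, vacA,
        Fin.prod_univ_succ]
      split_ifs <;> simp

theorem sixT_apply_zero (γ x : ℂ) : ∀ (n : ℕ) (μ : Fin n → ℂ) (s : Fin n → Fin 2),
    sixT n γ μ x 1 1 s (fun _ => 0) = if s = fun _ => 0 then vacD μ x else 0 := by
  intro n
  induction n with
  | zero => intro μ t; simp [sixT, auxT, vacD, Matrix.one_apply, eq_iff_true_of_subsingleton]
  | succ n ih =>
    intro μ s
    refine Fin.consCases (fun s₀ s => ?_) s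
    have hih := ih (fun i => μ i.succ) s
    have e := iceMatrix_entries (wa γ (x - μ 0)) (wb (x - μ 0)) (wc γ (x - μ 0)) (wc γ (x - μ 0))
      (wb (x - μ 0)) (wa γ (x - μ 0))
    rw [sixT] at hih ⊢
    rw [const_eq_cons, auxT_succ_cons]
    simp only [sixVertexR, Fin.sum_univ_two] at hih ⊢
    fin_cases s₀
    · simp only [Fin.zero_eta, e, zero_mul, zero_add, Fin.cons_inj, true_and, hih, vacD,
        Fin.prod_univ_succ]
      split_ifs <;> simp
    · simp only [Fin.mk_one, e, zero_mul, add_zero, Fin.cons_inj, one_ne_zero, false_and,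
        if_false]

theorem sixT_cons (n : ℕ) (γ x : ℂ) (μ : Fin (n + 1) → ℂ) (s t : Fin n → Fin 2) :
    sixT (n + 1) γ μ x 0 1 (Fin.cons 0 s) (Fin.cons 0 t) =
        wa γ (x - μ 0) * sixT n γ (fun i => μ i.succ) x 0 1 s t ∧
    sixT (n + 1) γ μ x 0 1 (Fin.cons 0 s) (Fin.cons 1 t) = 0 ∧
    sixT (n + 1) γ μ x 0 1 (Fin.cons 1 s) (Fin.cons 0 t) =
        sinh γ * sixT n γ (fun i => μ i.succ) x 1 1 s t ∧
    sixT (n + 1) γ μ x 0 1 (Fin.cons 1 s) (Fin.cons 1 t) =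
        wb (x - μ 0) * sixT n γ (fun i => μ i.succ) x 0 1 s t := by
  have e := iceMatrix_entries (wa γ (x - μ 0)) (wb (x - μ 0)) (wc γ (x - μ 0)) (wc γ (x - μ 0))
      (wb (x - μ 0)) (wa γ (x - μ 0))
  simp only [sixT, auxT_succ_cons, Fin.sum_univ_two]
  simp only [sixVertexR, e, zero_mul, zero_add, add_zero, true_and]
  trivial

/-- On the first site B is block triangular: the site can be flipped from v₁ to v₂ but never back,
so the diagonal blocks simply multiply. -/
theorem prodB_cons_zero (n : ℕ) (γ : ℂ) (μ : Fin (n + 1) → ℂ) (l : List ℂ) :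
    ∀ s t : Fin n → Fin 2,
    prodB (n + 1) γ μ l (Fin.cons 0 s) (Fin.cons 0 t) =
        (l.map fun x => wa γ (x - μ 0)).prod * prodB n γ (fun i => μ i.succ) l s t ∧
    prodB (n + 1) γ μ l (Fin.cons 0 s) (Fin.cons 1 t) = 0 ∧
    prodB (n + 1) γ μ l (Fin.cons 1 s) (Fin.cons 1 t) =
        (l.map fun x => wb (x - μ 0)).prod * prodB n γ (fun i => μ i.succ) l s t := by
  induction l with
  | nil =>
    intro s t
    simp [prodB_nil, Matrix.one_apply]
  | cons x l ih =>
    intro s t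
    simp only [prodB_cons, Matrix.mul_apply, sum_fin_succ_fun, Fin.sum_univ_two, sixT_cons, ih,
      List.map_cons, List.prod_cons, zero_mul, mul_zero, Finset.sum_const_zero, add_zero,
      zero_add, true_and, Finset.mul_sum]
    constructor <;> refine Finset.sum_congr rfl fun w _ => ?_ <;> ring

/-- Expansion with respect to the leftmost operator of the flip of the first site. -/
theorem prodB_flip_cons (n : ℕ) (γ : ℂ) (μ : Fin (n + 1) → ℂ) (x : ℂ) (l : List ℂ)
    (s t : Fin n → Fin 2) :
    prodB (n + 1) γ μ (x :: l) (Fin.cons 1 s) (Fin.cons 0 t) =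
      wb (x - μ 0) * ∑ w, sixT n γ (fun i => μ i.succ) x 0 1 s w *
        prodB (n + 1) γ μ l (Fin.cons 1 w) (Fin.cons 0 t) +
      sinh γ * (l.map fun x => wa γ (x - μ 0)).prod *
        (sixT n γ (fun i => μ i.succ) x 1 1 * prodB n γ (fun i => μ i.succ) l) s t := by
  simp only [prodB_cons, Matrix.mul_apply, sum_fin_succ_fun, Fin.sum_univ_two, sixT_cons,
    prodB_cons_zero, Finset.mul_sum]
  rw [add_comm]
  congr 1 <;> refine Finset.sum_congr rfl fun w _ => ?_ <;> ring

/-- Expansion with respect to the rightmost operator of the flip of the first site. -/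
theorem prodB_flip_concat (n : ℕ) (γ : ℂ) (μ : Fin (n + 1) → ℂ) (x : ℂ) (l : List ℂ)
    (s t : Fin n → Fin 2) :
    prodB (n + 1) γ μ (l ++ [x]) (Fin.cons 1 s) (Fin.cons 0 t) =
      wa γ (x - μ 0) * ∑ w, prodB (n + 1) γ μ l (Fin.cons 1 s) (Fin.cons 0 w) *
        sixT n γ (fun i => μ i.succ) x 0 1 w t +
      sinh γ * (l.map fun x => wb (x - μ 0)).prod *
        (prodB n γ (fun i => μ i.succ) l * sixT n γ (fun i => μ i.succ) x 1 1) s t := by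
  simp only [prodB_concat, Matrix.mul_apply, sum_fin_succ_fun, Fin.sum_univ_two, sixT_cons,
    prodB_cons_zero, Finset.mul_sum]
  congr 1 <;> refine Finset.sum_congr rfl fun w _ => ?_ <;> ring

/-- The recursion at `μ₀ = x₀`. -/
theorem sixVertexZ_of_wb_eq_zero (n : ℕ) (γ : ℂ) (μ x : Fin (n + 1) → ℂ)
    (h : wb (x 0 - μ 0) = 0) :
    sixVertexZ (n + 1) γ μ x = sinh γ * (∏ k : Fin n, wa γ (x k.succ - μ 0)) *
      vacA γ (fun i => μ i.succ) (x 0) *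
        sixVertexZ n γ (fun i => μ i.succ) (fun i => x i.succ) := by
  simp only [sixVertexZ_eq_prodB, List.ofFn_succ]
  -- As `b(x 0 - μ 0) = 0`, the leftmost operator must perform the flip; the resulting D block then
  -- meets its left eigenvector.
  rw [const_eq_cons 1, const_eq_cons 0, prodB_flip_cons, h, zero_mul, zero_add, Matrix.mul_apply]
  simp [sixT_apply_one, List.map_ofFn, List.prod_ofFn]
  ring

/-- The recursion at `μ₀ = x₀ + γ`. -/
theorem sixVertexZ_of_wa_eq_zero (n : ℕ) (γ : ℂ) (μ x : Fin (n + 1) → ℂ)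
    (h : wa γ (x 0 - μ 0) = 0) (hx : ∀ i j, wa γ (x i - x j) ≠ 0) :
    sixVertexZ (n + 1) γ μ x = sinh γ * (∏ k : Fin n, wb (x k.succ - μ 0)) *
      vacD (fun i => μ i.succ) (x 0) *
        sixVertexZ n γ (fun i => μ i.succ) (fun i => x i.succ) := by
  -- Commutation brings the operator at `x 0` to the right end. There `a(x 0 - μ 0) = 0` forces it
  -- to flip the first site, and D acts on `|0⟩`.
  have hperm : (x 0 :: List.ofFn fun i : Fin n => x i.succ).Perm
      ((List.ofFn fun i : Fin n => x i.succ) ++ [x 0]) := (List.perm_append_singleton _ _).symm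
  have hpair : (x 0 :: List.ofFn fun i : Fin n => x i.succ).Pairwise
      fun x y => wa γ (x - y) ≠ 0 := by
    rw [← List.ofFn_succ, List.pairwise_ofFn]
    exact fun i j _ => hx i j
  simp only [sixVertexZ_eq_prodB, List.ofFn_succ]
  rw [prodB_perm _ _ _ hperm hpair, const_eq_cons 1, const_eq_cons 0, prodB_flip_concat, h,
    zero_mul, zero_add, Matrix.mul_apply]
  simp [sixT_apply_zero, List.map_ofFn, List.prod_ofFn]
  ring

theorem sixVertexZ_comp_perm (n : ℕ) (γ : ℂ) (μ x : Fin n → ℂ) (σ : Equiv.Perm (Fin n))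
    (hx : ∀ i j, wa γ (x i - x j) ≠ 0) :
    sixVertexZ n γ μ (x ∘ σ) = sixVertexZ n γ μ x := by
  rw [sixVertexZ_eq_prodB, sixVertexZ_eq_prodB,
    prodB_perm n γ μ (σ.ofFn_comp_perm x) (List.pairwise_ofFn.mpr fun i j _ => hx _ _)]

end Creation

/-! ### The same recursions for the sum over subsets -/

section Recursion

theorem subsetSum_comp_perm {n m : ℕ} (γ : ℂ) (μ : Fin m → ℂ) (x : Fin n → ℂ) (w : ℂ)
    (σ : Equiv.Perm (Fin n)) : subsetSum γ μ (x ∘ σ) w = subsetSum γ μ x w := by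
  refine Fintype.sum_equiv (Equiv.arrowCongr σ (Equiv.refl Bool)) _ _ fun τ =>
    Fintype.prod_equiv σ _ _ fun j => ?_
  have : (∏ k, (if τ k then 1 else wa γ (x (σ k) - x (σ j)) / wb (x (σ k) - x (σ j)))) =
      ∏ k, (if (Equiv.arrowCongr σ (Equiv.refl Bool)) τ k then 1 else
        wa γ (x k - x (σ j)) / wb (x k - x (σ j))) :=
    Fintype.prod_equiv σ _ _ fun k => by simp
  simp [this]

theorem sum_fin_succ_bool {n : ℕ} (f : (Fin (n + 1) → Bool) → ℂ) :
    ∑ σ, f σ = ∑ τ : Fin n → Bool, (f (Fin.cons true τ) + f (Fin.cons false τ)) := by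
  rw [← (Fin.consEquiv (fun _ : Fin (n + 1) => Bool)).sum_comp, Fintype.sum_prod_type,
    Fintype.sum_bool, ← Finset.sum_add_distrib]
  rfl

theorem vacA_succ {n : ℕ} (γ : ℂ) (μ : Fin (n + 1) → ℂ) (u : ℂ) :
    vacA γ μ u = wa γ (u - μ 0) * vacA γ (fun i => μ i.succ) u := Fin.prod_univ_succ _

theorem vacD_succ {n : ℕ} (μ : Fin (n + 1) → ℂ) (u : ℂ) :
    vacD μ u = wb (u - μ 0) * vacD (fun i => μ i.succ) u := Fin.prod_univ_succ _

/-- The zero of `vacD μ (x 0)` removes all subsets not containing 0. In the others, each k outside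
the subset exchanges its factor `b(x_k - μ 0)` for `a(x_k - μ 0)`. -/
theorem subsetSum_of_eq {n m : ℕ} (γ : ℂ) (μ : Fin (m + 1) → ℂ) (x : Fin (n + 1) → ℂ) (w : ℂ)
    (h : μ 0 = x 0) (hx : ∀ i j, i ≠ j → wb (x i - x j) ≠ 0) :
    subsetSum γ μ x w = sinh γ * (∏ k : Fin n, wa γ (x k.succ - μ 0)) *
      vacA γ (fun i => μ i.succ) (x 0) * wa γ (w - x 0) *
        subsetSum γ (fun i => μ i.succ) (fun i => x i.succ) w := by
  rw [subsetSum, subsetSum, sum_fin_succ_bool, Finset.mul_sum]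
  refine Finset.sum_congr rfl fun τ _ => ?_
  have h0 : wb (x 0 - μ 0) = 0 := by simp [h, wb]
  have h1 : wa γ (x 0 - μ 0) = sinh γ := by simp [h, wa]
  have h2 : subsetTerm γ μ x w (Fin.cons false τ) = 0 := by
    rw [subsetTerm, Fin.prod_univ_succ]
    simp [vacD_succ, h0]
  have h3 : (∏ k : Fin n, wa γ (x k.succ - μ 0)) * subsetTerm γ (fun i => μ i.succ)
      (fun i => x i.succ) w τ = (∏ k : Fin n, (if τ k then 1 else
        wa γ (x k.succ - x 0) / wb (x k.succ - x 0))) *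
      ∏ j : Fin n, if τ j then vacA γ μ (x j.succ) * wa γ (w - x j.succ) *
        ∏ k : Fin n, (if τ k then 1 else wa γ (x k.succ - x j.succ) / wb (x k.succ - x j.succ))
      else vacD μ (x j.succ) * wb (x j.succ - w) := by
    rw [subsetTerm, ← Finset.prod_mul_distrib, ← Finset.prod_mul_distrib]
    refine Finset.prod_congr rfl fun j _ => ?_
    split_ifs with hj
    · rw [vacA_succ]; ring
    · have := hx j.succ 0 (Fin.succ_ne_zero j)
      rw [vacD_succ, h]
      field_simp
  have h4 : subsetTerm γ μ x w (Fin.cons true τ) = vacA γ μ (x 0) * wa γ (w - x 0) *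
      ((∏ k : Fin n, (if τ k then 1 else wa γ (x k.succ - x 0) / wb (x k.succ - x 0))) *
      ∏ j : Fin n, if τ j then vacA γ μ (x j.succ) * wa γ (w - x j.succ) *
        ∏ k : Fin n, (if τ k then 1 else wa γ (x k.succ - x j.succ) / wb (x k.succ - x j.succ))
      else vacD μ (x j.succ) * wb (x j.succ - w)) := by
    simp only [subsetTerm, Fin.prod_univ_succ, Fin.cons_zero, Fin.cons_succ, if_true, one_mul]
    ring
  rw [h2, h4, ← h3, vacA_succ, h1]
  ring

/-- Now `vacA μ (x 0) = 0` removes the subsets containing 0; the shift by γ exchanges a and b up to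
sign, which turns `a(x_j - μ 0)` into `b(x_j - μ 0)` for each j in the subset. -/
theorem subsetSum_of_eq_add {n m : ℕ} (γ : ℂ) (μ : Fin (m + 1) → ℂ) (x : Fin (n + 1) → ℂ) (w : ℂ)
    (h : μ 0 = x 0 + γ) (hx : ∀ i j, i ≠ j → wb (x i - x j) ≠ 0) :
    subsetSum γ μ x w = sinh γ * (∏ k : Fin n, wb (x k.succ - μ 0)) *
      vacD (fun i => μ i.succ) (x 0) * wb (w - x 0) *
        subsetSum γ (fun i => μ i.succ) (fun i => x i.succ) w := by
  rw [subsetSum, subsetSum, sum_fin_succ_bool, Finset.mul_sum]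
  refine Finset.sum_congr rfl fun τ _ => ?_
  have h0 : wa γ (x 0 - μ 0) = 0 := by simp [h, wa]
  have h1 : wb (x 0 - μ 0) = -sinh γ := by simp [h, wb]
  have h2 : subsetTerm γ μ x w (Fin.cons true τ) = 0 := by
    rw [subsetTerm, Fin.prod_univ_succ]
    simp [vacA_succ, h0]
  have h3 : (∏ k : Fin n, wb (x k.succ - μ 0)) * subsetTerm γ (fun i => μ i.succ)
      (fun i => x i.succ) w τ =
      ∏ j : Fin n, if τ j then vacA γ μ (x j.succ) * wa γ (w - x j.succ) *
        (wa γ (x 0 - x j.succ) / wb (x 0 - x j.succ) *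
        ∏ k : Fin n, (if τ k then 1 else wa γ (x k.succ - x j.succ) / wb (x k.succ - x j.succ)))
      else vacD μ (x j.succ) * wb (x j.succ - w) := by
    rw [subsetTerm, ← Finset.prod_mul_distrib]
    refine Finset.prod_congr rfl fun j _ => ?_
    split_ifs with hj
    · have e1 := hx 0 j.succ (Fin.succ_ne_zero j).symm
      have e2 : wa γ (x j.succ - μ 0) = -wb (x 0 - x j.succ) := by
        rw [h, ← wb_sub_comm, wa, wb]; congr 1; ring
      have e3 : wb (x j.succ - μ 0) = -wa γ (x 0 - x j.succ) := by
        rw [h, wa, wb, ← sinh_neg]; congr 1; ring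
      rw [vacA_succ, e2, e3]
      field_simp
    · rw [vacD_succ]; ring
  have h4 : subsetTerm γ μ x w (Fin.cons false τ) = vacD μ (x 0) * wb (x 0 - w) *
      ∏ j : Fin n, if τ j then vacA γ μ (x j.succ) * wa γ (w - x j.succ) *
        (wa γ (x 0 - x j.succ) / wb (x 0 - x j.succ) *
        ∏ k : Fin n, (if τ k then 1 else wa γ (x k.succ - x j.succ) / wb (x k.succ - x j.succ)))
      else vacD μ (x j.succ) * wb (x j.succ - w) := by
    simp [subsetTerm, Fin.prod_univ_succ]
  rw [h2, h4, ← h3, vacD_succ, h1, wb_sub_comm w]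
  ring

end Recursion

/-! ### Trigonometric polynomials and their zeros -/

section TrigPoly

/-- Trigonometric polynomials `e^{-nu} p(e^{2u})` with `p` of degree at most `n`. -/
def IsTrigPoly (n : ℕ) (f : ℂ → ℂ) : Prop :=
  ∃ p : Polynomial ℂ, p.natDegree ≤ n ∧ ∀ u, f u = exp (-(n * u)) * p.eval (exp (2 * u))

theorem IsTrigPoly.zero (n : ℕ) : IsTrigPoly n fun _ => 0 := ⟨0, by simp, by simp⟩

theorem IsTrigPoly.const (c : ℂ) : IsTrigPoly 0 fun _ => c :=
  ⟨Polynomial.C c, by simp, by simp⟩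

theorem IsTrigPoly.add {n : ℕ} {f g : ℂ → ℂ} (hf : IsTrigPoly n f) (hg : IsTrigPoly n g) :
    IsTrigPoly n fun u => f u + g u := by
  obtain ⟨p, hp, hfp⟩ := hf
  obtain ⟨q, hq, hgq⟩ := hg
  refine ⟨p + q, (Polynomial.natDegree_add_le _ _).trans (max_le hp hq), fun u => ?_⟩
  simp only [hfp, hgq, Polynomial.eval_add]
  ring

theorem IsTrigPoly.mul {n m : ℕ} {f g : ℂ → ℂ} (hf : IsTrigPoly n f) (hg : IsTrigPoly m g) :
    IsTrigPoly (n + m) fun u => f u * g u := by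
  obtain ⟨p, hp, hfp⟩ := hf
  obtain ⟨q, hq, hgq⟩ := hg
  refine ⟨p * q, Polynomial.natDegree_mul_le.trans (add_le_add hp hq), fun u => ?_⟩
  simp only [hfp, hgq, Polynomial.eval_mul]
  have : exp (-((n + m : ℕ) * u)) = exp (-(n * u)) * exp (-(m * u)) := by
    rw [← exp_add]; congr 1; push_cast; ring
  rw [this]
  ring

theorem IsTrigPoly.const_mul {n : ℕ} {f : ℂ → ℂ} (c : ℂ) (hf : IsTrigPoly n f) :
    IsTrigPoly n fun u => c * f u := by
  simpa using (IsTrigPoly.const c).mul hf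

theorem IsTrigPoly.sum {n : ℕ} {ι : Type*} (s : Finset ι) {f : ι → ℂ → ℂ}
    (hf : ∀ i ∈ s, IsTrigPoly n (f i)) : IsTrigPoly n fun u => ∑ i ∈ s, f i u := by
  classical
  induction s using Finset.induction_on with
  | empty => simpa using IsTrigPoly.zero n
  | insert i s hi ih =>
    simp only [Finset.sum_insert hi]
    exact (hf i (by simp)).add (ih fun j hj => hf j (by simp [hj]))

theorem IsTrigPoly.prod {ι : Type*} (s : Finset ι) {f : ι → ℂ → ℂ}
    (hf : ∀ i ∈ s, IsTrigPoly 1 (f i)) : IsTrigPoly s.card fun u => ∏ i ∈ s, f i u := by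
  classical
  induction s using Finset.induction_on with
  | empty => simpa using IsTrigPoly.const 1
  | insert i s hi ih =>
    simp only [Finset.prod_insert hi, Finset.card_insert_of_notMem hi]
    rw [add_comm]
    exact (hf i (by simp)).mul (ih fun j hj => hf j (by simp [hj]))

theorem isTrigPoly_sinh (v : ℂ) : IsTrigPoly 1 fun u => sinh (v - u) := by
  refine ⟨Polynomial.C (exp v / 2) - Polynomial.C (exp (-v) / 2) * Polynomial.X, ?_, fun u => ?_⟩
  · compute_degree
  · simp only [Complex.sinh, Polynomial.eval_sub, Polynomial.eval_mul, Polynomial.eval_C,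
      Polynomial.eval_X, Nat.cast_one, one_mul, mul_sub, neg_sub]
    rw [sub_eq_add_neg v u, exp_add, sub_eq_add_neg u v, exp_add, two_mul, exp_add]
    have : exp (-u) * exp u = 1 := by rw [← exp_add]; simp
    linear_combination (exp (-v) * exp u / 2) * this

theorem isTrigPoly_wb (v : ℂ) : IsTrigPoly 1 fun u => wb (v - u) := isTrigPoly_sinh v

theorem isTrigPoly_wa (γ v : ℂ) : IsTrigPoly 1 fun u => wa γ (v - u) := by
  have h : (fun u => wa γ (v - u)) = fun u => sinh (v + γ - u) := by
    funext u; rw [wa]; congr 1; ring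
  rw [h]
  exact isTrigPoly_sinh _

theorem isTrigPoly_list_prod (l : List ℂ) {f : ℂ → ℂ → ℂ} (hf : ∀ x, IsTrigPoly 1 (f x)) :
    IsTrigPoly l.length fun u => (l.map fun x => f x u).prod := by
  induction l with
  | nil => simpa using IsTrigPoly.const 1
  | cons x l ih =>
    simp only [List.map_cons, List.prod_cons, List.length_cons]
    rw [add_comm]
    exact (hf x).mul ih

/-- Distinctness modulo iπ becomes distinctness of the polynomial variable `exp (2 * u)`. -/
theorem exp_two_mul_eq_iff (u v : ℂ) : exp (2 * u) = exp (2 * v) ↔ sinh (u - v) = 0 := by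
  have h1 : exp (2 * u) = exp (u + v) * exp (u - v) := by rw [← exp_add]; congr 1; ring
  have h2 : exp (2 * v) = exp (u + v) * exp (-(u - v)) := by rw [← exp_add]; congr 1; ring
  rw [h1, h2, Complex.sinh, div_eq_zero_iff, sub_eq_zero, mul_right_inj' (exp_ne_zero _)]
  simp

/-- A trigonometric polynomial of degree `n` with more than `n` zeros modulo `iπ` vanishes. -/
theorem IsTrigPoly.eq_zero {n m : ℕ} {f : ℂ → ℂ} (hf : IsTrigPoly n f) (y : Fin m → ℂ)
    (hm : n < m) (hy : ∀ i j, i ≠ j → sinh (y i - y j) ≠ 0) (h0 : ∀ i, f (y i) = 0) (u : ℂ) :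
    f u = 0 := by
  obtain ⟨p, hp, hfp⟩ := hf
  have hinj : Function.Injective fun i => exp (2 * y i) := by
    intro i j hij
    by_contra hne
    exact hy i j hne ((exp_two_mul_eq_iff _ _).mp hij)
  have : p = 0 := by
    refine Polynomial.eq_zero_of_natDegree_lt_card_of_eval_eq_zero p hinj (fun i => ?_)
      (by simpa using hp.trans_lt hm)
    have := h0 i
    rw [hfp] at this
    exact (mul_eq_zero.mp this).resolve_left (exp_ne_zero _)
  simp [hfp, this]

end TrigPoly

/-! ### Z as a sum over subsets, by interpolation in the first inhomogeneity -/

section SumFormula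

/-- Exactly one operator flips the first site, with weight `sinh γ` free of u; each other operator
contributes one degree, and the extra factor `wa γ (w - u)` restores the total to `l.length`. -/
theorem isTrigPoly_prodB_flip (n : ℕ) (γ w : ℂ) (μ : Fin n → ℂ) (l : List ℂ) :
    ∀ s t : Fin n → Fin 2, IsTrigPoly l.length fun u =>
      prodB (n + 1) γ (Fin.cons u μ) l (Fin.cons 1 s) (Fin.cons 0 t) * wa γ (w - u) := by
  induction l with
  | nil =>
    intro s t
    simp only [prodB_nil, Matrix.one_apply, Fin.cons_inj, one_ne_zero, false_and, if_false,
      zero_mul]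
    exact IsTrigPoly.zero _
  | cons x l ih =>
    intro s t
    simp only [prodB_flip_cons, Fin.cons_zero, Fin.cons_succ, add_mul, List.length_cons]
    refine IsTrigPoly.add ?_ ?_
    · simp only [mul_assoc, Finset.sum_mul]
      rw [add_comm]
      exact (isTrigPoly_wb x).mul (IsTrigPoly.sum _ fun r _ => (ih r t).const_mul _)
    · have h := ((isTrigPoly_list_prod l (isTrigPoly_wa γ)).mul (isTrigPoly_wa γ w)).const_mul
        (sinh γ * (sixT n γ μ x 1 1 * prodB n γ μ l) s t)
      convert h using 2
      ring

theorem isTrigPoly_sixVertexZ (n : ℕ) (γ w : ℂ) (μ : Fin n → ℂ) (x : Fin (n + 1) → ℂ) :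
    IsTrigPoly (n + 1) fun u => sixVertexZ (n + 1) γ (Fin.cons u μ) x * wa γ (w - u) := by
  have := isTrigPoly_prodB_flip n γ w μ (List.ofFn x) (fun _ => 1) (fun _ => 0)
  rw [← const_eq_cons, ← const_eq_cons, List.length_ofFn] at this
  simpa only [sixVertexZ_eq_prodB] using this

theorem isTrigPoly_subsetSum (n m : ℕ) (γ w : ℂ) (μ : Fin m → ℂ) (x : Fin n → ℂ) :
    IsTrigPoly n fun u => subsetSum γ (Fin.cons u μ : Fin (m + 1) → ℂ) x w := by
  refine IsTrigPoly.sum _ fun σ _ => ?_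
  have h := IsTrigPoly.prod (Finset.univ : Finset (Fin n)) (f := fun j u =>
    if σ j then vacA γ (Fin.cons u μ : Fin (m + 1) → ℂ) (x j) * wa γ (w - x j) *
      ∏ k, (if σ k then 1 else wa γ (x k - x j) / wb (x k - x j))
    else vacD (Fin.cons u μ : Fin (m + 1) → ℂ) (x j) * wb (x j - w)) ?_
  · simpa [subsetTerm] using h
  · intro j _
    simp only [vacA_succ, vacD_succ, Fin.cons_zero, Fin.cons_succ]
    split_ifs
    · simpa only [mul_assoc, mul_comm, mul_left_comm] using (isTrigPoly_wa γ (x j)).const_mul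
        (vacA γ μ (x j) * wa γ (w - x j) *
          ∏ k, (if σ k then 1 else wa γ (x k - x j) / wb (x k - x j)))
    · simpa only [mul_assoc, mul_comm, mul_left_comm] using (isTrigPoly_wb (x j)).const_mul
        (vacD μ (x j) * wb (x j - w))

/-- The partition function as a sum over subsets, for generic `γ`. -/
theorem sixVertexZ_mul_vacA (γ w : ℂ) : ∀ (n : ℕ) (μ x : Fin n → ℂ)
    (_ : ∀ i j, i ≠ j → wb (x i - x j) ≠ 0) (_ : ∀ i j, wa γ (x i - x j) ≠ 0),
    sixVertexZ n γ μ x * vacA γ μ w = subsetSum γ μ x w := by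
  intro n
  induction n with
  | zero =>
    intro μ x _ _
    rw [sixVertexZ_eq_prodB]
    simp [prodB_nil, vacA, subsetSum, subsetTerm, Matrix.one_apply, eq_iff_true_of_subsingleton]
  | succ n ih =>
    intro μ x hb ha
    have key : ∀ (y : Fin (n + 1) → ℂ) (_ : ∀ i j, i ≠ j → wb (y i - y j) ≠ 0)
        (_ : ∀ i j, wa γ (y i - y j) ≠ 0) (μ : Fin (n + 1) → ℂ), μ 0 = y 0 ∨ μ 0 = y 0 + γ →
        sixVertexZ (n + 1) γ μ y * vacA γ μ w = subsetSum γ μ y w := by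
      intro y hyb hya μ hμ
      have hih := ih (fun i => μ i.succ) (fun i => y i.succ)
        (fun i j hij => hyb _ _ (by simpa using hij)) (fun i j => hya _ _)
      rw [vacA_succ]
      rcases hμ with hμ | hμ
      · rw [sixVertexZ_of_wb_eq_zero n γ μ y (by simp [hμ, wb]), subsetSum_of_eq γ μ y w hμ hyb,
          ← hih, hμ]
        ring
      · rw [sixVertexZ_of_wa_eq_zero n γ μ y (by simp [hμ, wa]) hya,
          subsetSum_of_eq_add γ μ y w hμ hyb, ← hih, hμ]
        have : wa γ (w - (y 0 + γ)) = wb (w - y 0) := by rw [wa, wb]; congr 1; ring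
        rw [this]
        ring
    set μ' : Fin n → ℂ := fun i => μ i.succ with hμ'
    have hcons : μ = Fin.cons (μ 0) μ' := (Fin.cons_self_tail μ).symm
    have hpoly : IsTrigPoly (n + 1) fun u =>
        vacA γ μ' w * (sixVertexZ (n + 1) γ (Fin.cons u μ') x * wa γ (w - u)) +
          (-1) * subsetSum γ (Fin.cons u μ' : Fin (n + 1) → ℂ) x w :=
      ((isTrigPoly_sixVertexZ n γ w μ' x).const_mul _).add
        ((isTrigPoly_subsetSum (n + 1) n γ w μ' x).const_mul _)
    -- The nodes are `x 0 + γ` and all the `x i`: n+2 zeros against degree n+1. They are distinct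
    -- modulo iπ by `ha` and `hb`.
    have hzero := hpoly.eq_zero (Fin.cons (x 0 + γ) x : Fin (n + 2) → ℂ) (Nat.lt_succ_self _)
      ?_ ?_ (μ 0)
    · rw [← hcons] at hzero
      rw [vacA_succ]
      linear_combination hzero
    · intro i j
      refine Fin.cases ?_ (fun i => ?_) i <;> refine Fin.cases ?_ (fun j => ?_) j
      · simp
      · intro _
        have := ha 0 j
        rw [wa] at this
        rwa [Fin.cons_zero, Fin.cons_succ, add_sub_right_comm]
      · intro _
        have := ha 0 i
        rw [wa] at this
        rw [Fin.cons_zero, Fin.cons_succ, ← neg_sub, sinh_neg, neg_ne_zero]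
        rwa [add_sub_right_comm]
      · intro hij
        exact hb i j (by simpa using hij)
    · intro i
      suffices h : sixVertexZ (n + 1) γ (Fin.cons ((Fin.cons (x 0 + γ) x : Fin (n + 2) → ℂ) i) μ') x *
          vacA γ (Fin.cons ((Fin.cons (x 0 + γ) x : Fin (n + 2) → ℂ) i) μ' : Fin (n + 1) → ℂ) w =
          subsetSum γ (Fin.cons ((Fin.cons (x 0 + γ) x : Fin (n + 2) → ℂ) i) μ' :
            Fin (n + 1) → ℂ) x w by
        rw [← h, vacA_succ]
        simp only [Fin.cons_zero, Fin.cons_succ]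
        ring
      refine Fin.cases ?_ (fun i => ?_) i
      · exact key x hb ha _ (Or.inr (by simp))
      -- Symmetry of both sides reduces the node `x i` to the node `x 0`.
      · rw [← sixVertexZ_comp_perm _ _ _ x (Equiv.swap 0 i) ha,
          ← subsetSum_comp_perm γ _ x w (Equiv.swap 0 i)]
        refine key _ (fun j k hjk => hb _ _ ?_) (fun j k => ha _ _) _ (Or.inl (by simp))
        exact fun h => hjk ((Equiv.swap 0 i).injective h)

end SumFormula

/-! ### Limits of partition functions and generic values of γ -/

section Continuity

theorem tendsto_iceMatrix {ι : Type*} {l : Filter ι} {f₁ f₂ f₃ f₄ f₅ f₆ : ι → ℂ}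
    {a₁ a₂ a₃ a₄ a₅ a₆ : ℂ} (h₁ : Tendsto f₁ l (𝓝 a₁)) (h₂ : Tendsto f₂ l (𝓝 a₂))
    (h₃ : Tendsto f₃ l (𝓝 a₃)) (h₄ : Tendsto f₄ l (𝓝 a₄)) (h₅ : Tendsto f₅ l (𝓝 a₅))
    (h₆ : Tendsto f₆ l (𝓝 a₆)) :
    Tendsto (fun n => iceMatrix (f₁ n) (f₂ n) (f₃ n) (f₄ n) (f₅ n) (f₆ n)) l
      (𝓝 (iceMatrix a₁ a₂ a₃ a₄ a₅ a₆)) := by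
  refine tendsto_pi_nhds.mpr fun u => tendsto_pi_nhds.mpr fun v => ?_
  obtain ⟨u₁, u₂⟩ := u
  obtain ⟨v₁, v₂⟩ := v
  fin_cases u₁ <;> fin_cases u₂ <;> fin_cases v₁ <;> fin_cases v₂ <;>
    first
    | exact h₁
    | exact h₂
    | exact h₃
    | exact h₄
    | exact h₅
    | exact h₆
    | exact tendsto_const_nhds

theorem tendsto_prod_ofFn {ι M : Type*} [Monoid M] [TopologicalSpace M] [ContinuousMul M]
    {l : Filter ι} {n : ℕ} {f : ι → Fin n → M} {g : Fin n → M}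
    (h : ∀ i, Tendsto (fun k => f k i) l (𝓝 (g i))) :
    Tendsto (fun k => (List.ofFn (f k)).prod) l (𝓝 (List.ofFn g).prod) := by
  simp only [List.ofFn_eq_map]
  exact tendsto_list_prod _ fun i _ => h i

/-- A partition function is a finite polynomial in vertex weights. This one statement serves
continuity in γ, the limit p → 0 and the limit Re τ → +∞. -/
theorem tendsto_partitionFunction {ι : Type*} {l : Filter ι} {L : ℕ}
    {R : ι → ℂ → ℂ → Matrix (Fin 2 × Fin 2) (Fin 2 × Fin 2) ℂ} {γ τ : ι → ℂ}
    {R' : ℂ → ℂ → Matrix (Fin 2 × Fin 2) (Fin 2 × Fin 2) ℂ} {γ' τ' : ℂ} {μ x : Fin L → ℂ}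
    (h : ∀ (j i : Fin L) (v : Fin L → Fin 2), Tendsto (fun n => R n (x j - μ i)
        (τ n + ((j : ℕ) + 1) * γ n -
          γ n * ∑ k ∈ Finset.univ.filter (fun k => i < k), hWeight (v k))) l
      (𝓝 (R' (x j - μ i) (τ' + ((j : ℕ) + 1) * γ' -
          γ' * ∑ k ∈ Finset.univ.filter (fun k => i < k), hWeight (v k))))) :
    Tendsto (fun n => partitionFunction L (R n) (γ n) μ x (τ n)) l
      (𝓝 (partitionFunction L R' γ' μ x τ')) := by
  have hentry : ∀ {m : Type} {M : ι → Matrix m m ℂ} {M' : Matrix m m ℂ},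
      Tendsto M l (𝓝 M') → ∀ s t, Tendsto (fun n => M n s t) l (𝓝 (M' s t)) :=
    fun hM s t => tendsto_pi_nhds.mp (tendsto_pi_nhds.mp hM s) t
  refine hentry (tendsto_prod_ofFn fun j => ?_) _ _
  refine tendsto_pi_nhds.mpr fun s => tendsto_pi_nhds.mpr fun t => ?_
  refine hentry (tendsto_prod_ofFn fun i => ?_) (0, s) (1, t)
  refine tendsto_pi_nhds.mpr fun u => tendsto_pi_nhds.mpr fun v => ?_
  simp only [localOp, Matrix.of_apply]
  split_ifs
  · exact hentry (h j i v.2) _ _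
  · exact tendsto_const_nhds

theorem prod_ofFn_smul {A : Type*} [Ring A] [Algebra ℂ A] (q : ℂ) : ∀ {n : ℕ} (f : Fin n → A),
    (List.ofFn fun i => q • f i).prod = q ^ n • (List.ofFn f).prod := by
  intro n
  induction n with
  | zero => intro f; simp
  | succ n ih =>
    intro f
    simp only [List.ofFn_succ, List.prod_cons, ih, smul_mul_smul_comm, pow_succ']

/-- The lattice has L² vertices, each contributing one factor q. -/
theorem partitionFunction_smul (L : ℕ) (R : ℂ → ℂ → Matrix (Fin 2 × Fin 2) (Fin 2 × Fin 2) ℂ)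
    (γ : ℂ) (μ x : Fin L → ℂ) (τ q : ℂ) :
    partitionFunction L (fun x τ => q • R x τ) γ μ x τ =
      q ^ (L ^ 2) * partitionFunction L R γ μ x τ := by
  have h1 : ∀ x τ i, localOp L (fun x τ => q • R x τ) γ μ x τ i = q • localOp L R γ μ x τ i := by
    intro x τ i
    ext u v
    simp [localOp]
  have h2 : ∀ x τ, opB L (fun x τ => q • R x τ) γ μ x τ = q ^ L • opB L R γ μ x τ := by
    intro x τ
    ext s t
    simp only [opB, monodromy, h1, prod_ofFn_smul, Matrix.of_apply, Matrix.smul_apply]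
  simp only [partitionFunction, h2, prod_ofFn_smul, Matrix.smul_apply, smul_eq_mul]
  rw [← pow_mul, sq]

theorem continuous_sixVertexZ (L : ℕ) (μ x : Fin L → ℂ) :
    Continuous fun γ => sixVertexZ L γ μ x := by
  refine continuous_iff_continuousAt.mpr fun γ => ?_
  refine tendsto_partitionFunction (R := fun γ x _ => sixVertexR γ x) (γ := fun γ => γ)
    (τ := fun _ => 0) fun j i v => ?_
  have ha : Tendsto (fun γ => wa γ (x j - μ i)) (𝓝 γ) (𝓝 (wa γ (x j - μ i))) := by
    have : Continuous fun γ => wa γ (x j - μ i) := by unfold wa; fun_prop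
    exact this.tendsto γ
  have hc : Tendsto (fun γ => wc γ (x j - μ i)) (𝓝 γ) (𝓝 (wc γ (x j - μ i))) := by
    have : Continuous fun γ => wc γ (x j - μ i) := by unfold wc; fun_prop
    exact this.tendsto γ
  exact tendsto_iceMatrix ha tendsto_const_nhds hc hc tendsto_const_nhds ha

theorem continuous_wa (u : ℂ) : Continuous fun γ => wa γ u := by unfold wa; fun_prop

theorem continuous_wc (u : ℂ) : Continuous fun γ => wc γ u := by unfold wc; fun_prop

theorem continuous_matV (L : ℕ) (μ x : Fin L → ℂ) (x₀ : ℂ) (α β : Fin L) :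
    Continuous fun γ => matV L γ μ x x₀ α β := by
  simp only [matV, Matrix.of_apply]
  have := continuous_wa
  have := continuous_wc
  split_ifs <;> fun_prop

theorem continuous_det_matV (L : ℕ) (μ x : Fin L → ℂ) (x₀ : ℂ) :
    Continuous fun γ => (matV L γ μ x x₀).det :=
  Continuous.matrix_det (continuous_matrix fun α β => continuous_matV L μ x x₀ α β)

theorem continuous_det_matVi (L : ℕ) (μ x : Fin L → ℂ) (x₀ : ℂ) (i : Fin L) :
    Continuous fun γ => (matVi L γ μ x x₀ i).det := by
  refine Continuous.matrix_det (continuous_matrix fun α β => ?_)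
  simp only [matVi, Matrix.of_apply]
  have := continuous_wa
  have := continuous_wc
  split_ifs
  · fun_prop
  · exact continuous_matV L μ x x₀ α β

/-- The excluded values form countably many translates of iπℤ. -/
theorem dense_sinh_add_ne_zero {D : Set ℂ} (hD : D.Countable) :
    Dense {γ : ℂ | ∀ d ∈ D, sinh (d + γ) ≠ 0} := by
  have h : {γ : ℂ | ∀ d ∈ D, sinh (d + γ) ≠ 0}ᶜ ⊆
      ⋃ d ∈ D, Set.range fun n : ℤ => n * (Real.pi * I) - d := by
    intro γ hγ
    simp only [Set.mem_compl_iff, Set.mem_ofPred_eq, not_forall, not_not] at hγ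
    obtain ⟨d, hd, h0⟩ := hγ
    have h1 := (exp_two_mul_eq_iff (d + γ) 0).mpr (by simpa using h0)
    rw [mul_zero, exp_zero, exp_eq_one_iff] at h1
    obtain ⟨n, hn⟩ := h1
    simp only [Set.mem_iUnion, Set.mem_range]
    exact ⟨d, hd, n, by linear_combination -hn / 2⟩
  have hc : ({γ : ℂ | ∀ d ∈ D, sinh (d + γ) ≠ 0}ᶜ).Countable :=
    (hD.biUnion fun d _ => Set.countable_range _).mono h
  simpa using hc.dense_compl ℂ

end Continuity

/-! ### Determinant formulae for all γ -/

section DeterminantFormulae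

theorem dense_wa_sub_ne_zero {S : Set ℂ} (hS : S.Countable) :
    Dense {γ : ℂ | ∀ u ∈ S, ∀ v ∈ S, wa γ (u - v) ≠ 0} := by
  refine (dense_sinh_add_ne_zero (hS.image2 hS fun u v => u - v)).mono ?_
  intro γ hγ u hu v hv
  exact hγ (u - v) (Set.mem_image2_of_mem hu hv)

/-- All denominators are values of b, independent of γ, so both sides are continuous in γ and
agreement on a dense set suffices. -/
theorem sixVertexZ_mul_prod_eq_det {L : ℕ} (γ : ℂ) (μ x : Fin L → ℂ) (x₀ : ℂ)
    (hx : ∀ i j, i ≠ j → wb (x i - x j) ≠ 0) (hx₀ : ∀ i, wb (x i - x₀) ≠ 0) :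
    sixVertexZ L γ μ x * ∏ k, wa γ (x₀ - μ k) =
      (matV L γ μ x x₀).det * ∏ k, wb (x k - x₀) := by
  have h1 : Continuous fun γ => sixVertexZ L γ μ x * ∏ k, wa γ (x₀ - μ k) :=
    (continuous_sixVertexZ L μ x).mul (continuous_finsetProd _ fun k _ => continuous_wa _)
  have h2 : Continuous fun γ => (matV L γ μ x x₀).det * ∏ k, wb (x k - x₀) :=
    (continuous_det_matV L μ x x₀).mul continuous_const
  have hS : (insert x₀ (Set.range x)).Countable := (Set.countable_range x).insert x₀
  refine congrFun (h1.ext_on (dense_wa_sub_ne_zero hS) h2 fun γ hγ => ?_) γ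
  have hγ0 : sinh γ ≠ 0 := by simpa [wa] using hγ x₀ (by simp) x₀ (by simp)
  have ha : ∀ i j, wa γ (x i - x j) ≠ 0 := fun i j => hγ _ (by simp) _ (by simp)
  exact (sixVertexZ_mul_vacA γ x₀ L μ x hx ha).trans
    (det_matV_mul_prod γ μ x x₀ hγ0 hx hx₀ ha).symm

theorem sixVertexZ_update_mul_prod_eq_det {L : ℕ} (γ : ℂ) (μ x : Fin L → ℂ) (x₀ : ℂ)
    (hx : ∀ i j, i ≠ j → wb (x i - x j) ≠ 0) (hx₀ : ∀ i, wb (x i - x₀) ≠ 0) (i : Fin L) :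
    sixVertexZ L γ μ (Function.update x i x₀) * ∏ k, wa γ (x₀ - μ k) =
      (matVi L γ μ x x₀ i).det * ∏ k, wb (x k - x₀) := by
  have h1 : Continuous fun γ =>
      sixVertexZ L γ μ (Function.update x i x₀) * ∏ k, wa γ (x₀ - μ k) :=
    (continuous_sixVertexZ L μ _).mul (continuous_finsetProd _ fun k _ => continuous_wa _)
  have h2 : Continuous fun γ => (matVi L γ μ x x₀ i).det * ∏ k, wb (x k - x₀) :=
    (continuous_det_matVi L μ x x₀ i).mul continuous_const
  have hx' : ∀ j k, j ≠ k →
      wb (Function.update x i x₀ j - Function.update x i x₀ k) ≠ 0 := by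
    intro j k hjk
    simp only [Function.update_apply]
    split_ifs with hj hk hk
    · exact absurd (hj.trans hk.symm) hjk
    · rw [wb_sub_comm]; exact neg_ne_zero.mpr (hx₀ k)
    · exact hx₀ j
    · exact hx j k hjk
  have hS : (insert x₀ (Set.range x)).Countable := (Set.countable_range x).insert x₀
  refine congrFun (h1.ext_on (dense_wa_sub_ne_zero hS) h2 fun γ hγ => ?_) γ
  have hγ0 : sinh γ ≠ 0 := by simpa [wa] using hγ x₀ (by simp) x₀ (by simp)
  have ha : ∀ i j, wa γ (x i - x j) ≠ 0 := fun i j => hγ _ (by simp) _ (by simp)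
  have ha₀ : ∀ i, wa γ (x i - x₀) ≠ 0 := fun i => hγ _ (by simp) _ (by simp)
  have hmem : ∀ j, Function.update x i x₀ j ∈ insert x₀ (Set.range x) := by
    intro j
    rw [Function.update_apply]
    split_ifs <;> simp
  exact (sixVertexZ_mul_vacA γ x₀ L μ _ hx' fun j k => hγ _ (hmem j) _ (hmem k)).trans
    (det_matVi_mul_prod γ μ x x₀ i hγ0 hx hx₀ ha ha₀).symm

end DeterminantFormulae

/-! ### Gauge equivalence with the six-vertex model -/

section Gauge

/-- The `R`-matrix obtained from the dynamical trigonometric one as `Re τ → +∞`. -/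
def gaugedR (γ x : ℂ) : Matrix (Fin 2 × Fin 2) (Fin 2 × Fin 2) ℂ :=
  iceMatrix (sinh (x + γ)) (exp (-γ) * sinh x) (exp (-x) * sinh γ) (exp x * sinh γ)
    (exp γ * sinh x) (sinh (x + γ))

/-- The total weight of a basis vector. -/
def totalWeight {n : ℕ} (s : Fin n → Fin 2) : ℂ := ∑ k, hWeight (s k)

/-- The weight of a basis vector, graded by the position of the sites. -/
def momentWeight {n : ℕ} (s : Fin n → Fin 2) : ℂ := ∑ k : Fin n, (k : ℕ) * hWeight (s k)

/-- The weight of a basis vector, weighted by the inhomogeneities. -/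
def inhomWeight {n : ℕ} (μ : Fin n → ℂ) (s : Fin n → Fin 2) : ℂ := ∑ k, μ k * hWeight (s k)

theorem totalWeight_cons {n : ℕ} (s₀ : Fin 2) (s : Fin n → Fin 2) :
    totalWeight (Fin.cons s₀ s : Fin (n + 1) → Fin 2) = hWeight s₀ + totalWeight s := by
  simp [totalWeight, Fin.sum_univ_succ]

theorem momentWeight_cons {n : ℕ} (s₀ : Fin 2) (s : Fin n → Fin 2) :
    momentWeight (Fin.cons s₀ s : Fin (n + 1) → Fin 2) = momentWeight s + totalWeight s := by
  simp [momentWeight, totalWeight, Fin.sum_univ_succ, add_mul, Finset.sum_add_distrib]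

theorem inhomWeight_cons {n : ℕ} (μ : Fin (n + 1) → ℂ) (s₀ : Fin 2) (s : Fin n → Fin 2) :
    inhomWeight μ (Fin.cons s₀ s) = μ 0 * hWeight s₀ + inhomWeight (fun i => μ i.succ) s := by
  simp [inhomWeight, Fin.sum_univ_succ]

theorem hWeight_zero : hWeight 0 = 1 := by simp [hWeight]

theorem hWeight_one : hWeight 1 = -1 := by simp [hWeight]

/-- Conservation of the total weight. -/
theorem weight_conservation (γ x : ℂ) : ∀ (n : ℕ) (μ : Fin n → ℂ) (a b : Fin 2)
    (s t : Fin n → Fin 2), sixT n γ μ x a b s t ≠ 0 →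
      hWeight a + totalWeight s = hWeight b + totalWeight t := by
  intro n
  induction n with
  | zero =>
    intro μ a b s t h
    have : a = b := by
      by_contra hab
      simp [sixT, auxT, hab] at h
    simp [this, totalWeight]
  | succ n ih =>
    intro μ a b s t
    refine Fin.consCases (fun s₀ s => ?_) s
    refine Fin.consCases (fun t₀ t => ?_) t
    intro h
    rw [sixT, auxT_succ_cons] at h
    obtain ⟨e, -, he⟩ := Finset.exists_ne_zero_of_sum_ne_zero h
    have h1 := ih (fun i => μ i.succ) e b s t (right_ne_zero_of_mul he)
    have h2 : hWeight a + hWeight s₀ = hWeight e + hWeight t₀ := by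
      have h3 := left_ne_zero_of_mul he
      clear h1 he h
      fin_cases a <;> fin_cases s₀ <;> fin_cases e <;> fin_cases t₀ <;>
        first
        | exact absurd rfl h3
        | simp [hWeight]
    rw [totalWeight_cons, totalWeight_cons]
    linear_combination h1 + h2

/-- The exponent of the gauge factor relating the monodromy matrices of `gaugedR` and
`sixVertexR`. -/
def gaugeExponent (n : ℕ) (γ : ℂ) (μ : Fin n → ℂ) (x : ℂ) (a b : Fin 2) (s t : Fin n → Fin 2) :
    ℂ :=
  -(x / 2) * (hWeight a - hWeight b) - (inhomWeight μ s - inhomWeight μ t) / 2 -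
    γ / 2 * (n * hWeight b - momentWeight s - totalWeight s + momentWeight t)

theorem auxT_gaugedR (γ x : ℂ) : ∀ (n : ℕ) (μ : Fin n → ℂ) (a b : Fin 2) (s t : Fin n → Fin 2),
    auxT n (fun i => gaugedR γ (x - μ i)) a b s t =
      exp (gaugeExponent n γ μ x a b s t) * sixT n γ μ x a b s t := by
  intro n
  induction n with
  | zero =>
    intro μ a b s t
    by_cases hab : a = b
    · simp [sixT, auxT, hab, gaugeExponent, inhomWeight, momentWeight, totalWeight]
    · simp [sixT, auxT, hab]
  | succ n ih =>
    intro μ a b s t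
    refine Fin.consCases (fun s₀ s => ?_) s
    refine Fin.consCases (fun t₀ t => ?_) t
    rw [sixT, auxT_succ_cons, auxT_succ_cons, Finset.mul_sum]
    refine Finset.sum_congr rfl fun e _ => ?_
    rw [ih (fun i => μ i.succ)]
    by_cases h0 : sixT n γ (fun i => μ i.succ) x e b s t = 0
    · rw [h0]
      rw [sixT] at h0
      rw [h0]
      simp
    have hcons := weight_conservation γ x n _ e b s t h0
    -- The exponents agree for each intermediate state e separately; weight conservation on the
    -- remaining sites is what removes their dependence on e.
    change _ = _ * (_ * sixT n γ (fun i => μ i.succ) x e b s t)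
    rw [← mul_assoc, ← mul_assoc]
    congr 1
    have e₁ := iceMatrix_entries (sinh (x - μ 0 + γ)) (exp (-γ) * sinh (x - μ 0))
      (exp (-(x - μ 0)) * sinh γ) (exp (x - μ 0) * sinh γ) (exp γ * sinh (x - μ 0))
      (sinh (x - μ 0 + γ))
    have e₂ := iceMatrix_entries (wa γ (x - μ 0)) (wb (x - μ 0)) (wc γ (x - μ 0)) (wc γ (x - μ 0))
      (wb (x - μ 0)) (wa γ (x - μ 0))
    have hexp : ∀ {u v w : ℂ} (y : ℂ), u + v = w → exp u * y * exp v = exp w * y := by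
      intro u v w y h
      rw [← h, exp_add]
      ring
    have hexp' : ∀ {v w : ℂ} (y : ℂ), v = w → y * exp v = exp w * y := by
      intro v w y h
      rw [h, mul_comm]
    rw [gaugedR, sixVertexR]
    fin_cases a <;> fin_cases s₀ <;> fin_cases e <;> fin_cases t₀ <;>
      simp only [Fin.zero_eta, Fin.mk_one, e₁, e₂, zero_mul, mul_zero] <;>
      first
      | refine hexp _ ?_
        simp only [gaugeExponent, totalWeight_cons, momentWeight_cons, inhomWeight_cons,
          Fin.zero_eta, Fin.mk_one, hWeight_zero, hWeight_one, Nat.cast_succ] at hcons ⊢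
        linear_combination (-γ / 2) * hcons
      | refine hexp' _ ?_
        simp only [gaugeExponent, totalWeight_cons, momentWeight_cons, inhomWeight_cons,
          Fin.zero_eta, Fin.mk_one, hWeight_zero, hWeight_one, Nat.cast_succ] at hcons ⊢
        linear_combination (-γ / 2) * hcons

/-- The diagonal part of the gauge factor for the operators `B`. -/
def gaugePotential {n : ℕ} (γ : ℂ) (μ : Fin n → ℂ) (s : Fin n → Fin 2) : ℂ :=
  -inhomWeight μ s / 2 + γ / 2 * momentWeight s - γ / 8 * totalWeight s ^ 2

/-- B raises the total weight from s to t by 2, so the term linear in `totalWeight s` is, up to a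
constant, a difference of squares. The gauge factor thus becomes a difference of potentials, which
telescopes in products. -/
theorem auxT_gaugedR_zero_one (γ x : ℂ) (n : ℕ) (μ : Fin n → ℂ) (s t : Fin n → Fin 2) :
    auxT n (fun i => gaugedR γ (x - μ i)) 0 1 s t =
      exp (-x + γ / 2 * (n - 1) + gaugePotential γ μ s - gaugePotential γ μ t) *
        sixT n γ μ x 0 1 s t := by
  rw [auxT_gaugedR]
  by_cases h0 : sixT n γ μ x 0 1 s t = 0
  · simp [h0]
  have hcons := weight_conservation γ x n μ 0 1 s t h0
  congr 2
  simp only [gaugeExponent, gaugePotential, hWeight_zero, hWeight_one] at hcons ⊢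
  have hs : totalWeight t = totalWeight s + 2 := by linear_combination -hcons
  rw [hs]
  ring

theorem prod_auxT_gaugedR (γ : ℂ) (n : ℕ) (μ : Fin n → ℂ) (l : List ℂ) :
    ∀ s t : Fin n → Fin 2,
    (l.map fun x => auxT n (fun i => gaugedR γ (x - μ i)) 0 1).prod s t =
      exp (-l.sum + l.length * (γ / 2 * (n - 1)) + gaugePotential γ μ s - gaugePotential γ μ t) *
        prodB n γ μ l s t := by
  induction l with
  | nil =>
    intro s t
    by_cases h : s = t
    · simp [h, prodB_nil]
    · simp [h, prodB_nil]
  | cons x l ih =>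
    intro s t
    rw [List.map_cons, List.prod_cons, prodB_cons, Matrix.mul_apply, Matrix.mul_apply,
      Finset.mul_sum]
    refine Finset.sum_congr rfl fun w _ => ?_
    rw [ih, auxT_gaugedR_zero_one]
    have : exp (-(x :: l).sum + (x :: l).length * (γ / 2 * (n - 1)) + gaugePotential γ μ s -
        gaugePotential γ μ t) =
        exp (-x + γ / 2 * (n - 1) + gaugePotential γ μ s - gaugePotential γ μ w) *
        exp (-l.sum + l.length * (γ / 2 * (n - 1)) + gaugePotential γ μ w -
          gaugePotential γ μ t) := by
      rw [← exp_add]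
      congr 1
      simp only [List.sum_cons, List.length_cons, Nat.cast_succ]
      ring
    rw [this]
    ring

theorem partitionFunction_gaugedR (L : ℕ) (γ τ : ℂ) (μ x : Fin L → ℂ) :
    partitionFunction L (fun x _ => gaugedR γ x) γ μ x τ =
      exp (-∑ j, (x j - μ j)) * sixVertexZ L γ μ x := by
  have h : (fun j : Fin L => opB L (fun x _ => gaugedR γ x) γ μ (x j)
      (τ + ((j : ℕ) + 1) * γ)) = (fun x => auxT L (fun i => gaugedR γ (x - μ i)) 0 1) ∘ x := by
    funext j
    ext s t
    exact monodromy_eq_auxT _ _ _ _ _ _ _ _ _ _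
  rw [partitionFunction, h, ← List.map_ofFn, prod_auxT_gaugedR, sixVertexZ_eq_prodB]
  congr 2
  -- Between the two reference states the moment terms cancel the accumulated `L * (γ / 2 * (L -
  -- 1))`.
  have hsum : ∑ k : Fin L, ((k : ℕ) : ℂ) = L * (L - 1) / 2 := by
    rw [Fin.sum_univ_eq_sum_range fun k : ℕ => (k : ℂ)]
    clear h x μ
    induction L with
    | zero => simp
    | succ n ih => rw [Finset.sum_range_succ, ih]; push_cast; ring
  simp only [gaugePotential, inhomWeight, momentWeight, totalWeight, hWeight_zero, hWeight_one,
    mul_neg, mul_one, Finset.sum_neg_distrib, Finset.sum_const, Finset.card_univ, Fintype.card_fin,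
    nsmul_eq_mul, hsum, List.sum_ofFn, List.length_ofFn, Finset.sum_sub_distrib]
  ring

end Gauge

/-! ### The trigonometric limit p → 0 and the limit Re τ → +∞ -/

section Limits

theorem tendsto_sinh_add_div_sinh_add (u v : ℂ) :
    Tendsto (fun τ : ℂ => sinh (τ + u) * (sinh (τ + v))⁻¹) (comap re atTop) (𝓝 (exp (u - v))) := by
  have h0 : Tendsto (fun τ : ℂ => exp (-(2 * τ))) (comap re atTop) (𝓝 0) := by
    refine tendsto_exp_comap_re_atBot.comp (tendsto_comap_iff.mpr ?_)
    have : (re ∘ fun τ : ℂ => -(2 * τ)) = fun τ => -(2 * re τ) := by funext τ; simp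
    rw [this]
    exact tendsto_neg_atTop_atBot.comp (tendsto_comap.const_mul_atTop two_pos)
  have h1 : ∀ u : ℂ, Tendsto (fun τ : ℂ => exp u - exp (-u) * exp (-(2 * τ))) (comap re atTop)
      (𝓝 (exp u)) := by
    intro u
    simpa using tendsto_const_nhds.sub (h0.const_mul (exp (-u)))
  have h2 := (h1 u).mul ((h1 v).inv₀ (exp_ne_zero v))
  rw [← exp_neg, ← exp_add, ← sub_eq_add_neg] at h2
  refine h2.congr fun τ => ?_
  have h3 : ∀ u : ℂ, sinh (τ + u) = exp τ / 2 * (exp u - exp (-u) * exp (-(2 * τ))) := by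
    intro u
    rw [Complex.sinh, exp_add, neg_add, exp_add, show -(2 * τ) = -τ + -τ by ring, exp_add]
    have : exp τ * exp (-τ) = 1 := by rw [← exp_add]; simp
    linear_combination (exp (-u) * exp (-τ) / 2) * this
  have h4 : exp τ / 2 ≠ 0 := div_ne_zero (exp_ne_zero _) two_ne_zero
  rw [h3 u, h3 v, mul_inv, mul_mul_mul_comm, mul_inv_cancel₀ h4, one_mul]

theorem sinh_ne_zero_of_re_pos {z : ℂ} (h : 0 < z.re) : sinh z ≠ 0 := by
  intro h0
  have h1 := (exp_two_mul_eq_iff z 0).mpr (by simpa using h0)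
  have h2 := congrArg norm h1
  rw [Complex.norm_exp, mul_zero, exp_zero, norm_one, Real.exp_eq_one_iff] at h2
  simp at h2
  exact h.ne' h2

theorem eventually_sinh_add_ne_zero (u : ℂ) :
    ∀ᶠ τ : ℂ in comap re atTop, sinh (τ + u) ≠ 0 := by
  have : ∀ᶠ τ : ℂ in comap re atTop, -u.re < τ.re := tendsto_comap.eventually_gt_atTop _
  filter_upwards [this] with τ hτ
  refine sinh_ne_zero_of_re_pos ?_
  rw [add_re]
  linarith

/-- The normalising factor of the theta function. -/
def thetaNorm (p : ℝ) : ℂ := -I * ((p ^ (-(1 / 4) : ℝ) : ℝ) : ℂ)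

theorem neg_one_cpow_sub_half (n : ℤ) :
    (-1 : ℂ) ^ ((n : ℂ) - 1 / 2) = -I * (-1) ^ n := by
  rw [cpow_sub _ _ (by norm_num), cpow_intCast]
  have : (-1 : ℂ) ^ (1 / 2 : ℂ) = I := by
    rw [cpow_def_of_ne_zero (by norm_num), log_neg_one,
      show (Real.pi : ℂ) * I * (1 / 2) = Real.pi / 2 * I by ring, exp_pi_div_two_mul_I]
  rw [this, div_I]
  ring

/-- Since (n + 1/2)² - 1/4 = n(n + 1), the normalised series has non-negative integer exponents of
p, vanishing only at n = 0 and n = -1. -/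
theorem thetaNorm_mul_theta {p : ℝ} (hp : 0 < p) (x : ℂ) :
    thetaNorm p * theta p x = -(1 / 2) * ∑' n : ℤ, (-1 : ℂ) ^ n *
      ((p ^ ((n : ℝ) * (n + 1)) : ℝ) : ℂ) * exp (-(2 * (n : ℂ) + 1) * x) := by
  rw [theta, mul_left_comm, neg_mul, ← mul_neg, ← tsum_mul_left, ← tsum_neg]
  congr 2
  funext n
  have h1 : p ^ ((n : ℝ) * (n + 1)) = p ^ (-(1 / 4) : ℝ) * p ^ (((n : ℝ) + 1 / 2) ^ 2) := by
    rw [← Real.rpow_add hp]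
    congr 1
    ring
  rw [neg_one_cpow_sub_half, h1, thetaNorm]
  push_cast
  linear_combination ((p ^ (-(1 / 4) : ℝ) : ℝ) : ℂ) * ((p ^ (((n : ℝ) + 1 / 2) ^ 2) : ℝ) : ℂ) *
    (-1) ^ n * exp (-(2 * (n : ℂ) + 1) * x) * I_sq

theorem int_mul_succ_nonneg (n : ℤ) : 0 ≤ n * (n + 1) := by
  rcases le_or_gt 0 n with h | h
  · positivity
  · nlinarith

theorem summable_theta_bound (c : ℝ) :
    Summable fun n : ℤ => Real.exp (-((n : ℝ) * (n + 1)) + |2 * (n : ℝ) + 1| * c) := by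
  -- The quadratic exponent absorbs the linear one; the constant generously exceeds the maximum
  -- obtained by completing the square in |n|.
  have h : Summable fun n : ℤ => Real.exp ((2 * |c| + 2) ^ 2 + |c|) * Real.exp (-|(n : ℝ)|) := by
    refine Summable.mul_left _ ?_
    have hgeo : Summable fun n : ℕ => Real.exp (-(n : ℝ)) := Real.summable_exp_neg_nat
    refine Summable.of_nat_of_neg ?_ ?_
    · simpa using hgeo
    · simpa using hgeo
  refine Summable.of_nonneg_of_le (fun _ => (Real.exp_pos _).le) (fun n => ?_) h
  rw [← Real.exp_add, Real.exp_le_exp]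
  have h1 : |2 * (n : ℝ) + 1| ≤ 2 * |(n : ℝ)| + 1 := by
    refine (abs_add_le _ _).trans ?_
    rw [abs_mul]
    simp
  have h2 : |2 * (n : ℝ) + 1| * c ≤ (2 * |(n : ℝ)| + 1) * |c| :=
    (mul_le_mul_of_nonneg_left (le_abs_self c) (abs_nonneg _)).trans
      (mul_le_mul_of_nonneg_right h1 (abs_nonneg c))
  have h3 : (n : ℝ) * n = |(n : ℝ)| * |(n : ℝ)| := (abs_mul_abs_self _).symm
  have h4 := neg_abs_le (n : ℝ)
  nlinarith [sq_nonneg (|(n : ℝ)| - (|c| + 1)), abs_nonneg c]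

/-- The trigonometric limit of the theta function. -/
theorem tendsto_theta (x : ℂ) :
    Tendsto (fun p : ℝ => thetaNorm p * theta p x) (𝓝[>] 0) (𝓝 (sinh x)) := by
  set g : ℤ → ℂ := fun n => if n = 0 ∨ n = -1 then (-1 : ℂ) ^ n * exp (-(2 * (n : ℂ) + 1) * x)
    else 0 with hg
  -- For p < 1/e the power of p is at most `exp (-(n * (n + 1)))`, which gives a p-independent
  -- summable bound.
  have hsmall : ∀ᶠ p : ℝ in 𝓝[>] 0, 0 < p ∧ p < Real.exp (-1) := by
    refine Filter.Eventually.and self_mem_nhdsWithin ?_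
    exact mem_nhdsWithin_of_mem_nhds (Iio_mem_nhds (Real.exp_pos _))
  have hlim : Tendsto (fun p : ℝ => ∑' n : ℤ, (-1 : ℂ) ^ n * ((p ^ ((n : ℝ) * (n + 1)) : ℝ) : ℂ) *
      exp (-(2 * (n : ℂ) + 1) * x)) (𝓝[>] 0) (𝓝 (∑' n, g n)) := by
    refine tendsto_tsum_of_dominated_convergence (summable_theta_bound ‖x‖) (fun n => ?_) ?_
    · by_cases hn : n = 0 ∨ n = -1
      · have : (n : ℝ) * (n + 1) = 0 := by rcases hn with rfl | rfl <;> simp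
        simp only [hg, hn, if_true, this, Real.rpow_zero, ofReal_one, mul_one]
        exact tendsto_const_nhds
      · have hpos : 0 < (n : ℝ) * (n + 1) := by
          push Not at hn
          have h1 : 0 < n * (n + 1) :=
            lt_of_le_of_ne (int_mul_succ_nonneg n)
              (mul_ne_zero hn.1 fun h => hn.2 (by linarith)).symm
          exact_mod_cast h1
        have h1 : Tendsto (fun p : ℝ => p ^ ((n : ℝ) * (n + 1))) (𝓝[>] 0) (𝓝 0) := by
          have := (Real.continuousAt_rpow_const 0 _ (Or.inr hpos.le)).tendsto
          rw [Real.zero_rpow hpos.ne'] at this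
          exact this.mono_left nhdsWithin_le_nhds
        have h2 : Tendsto (fun p : ℝ => ((p ^ ((n : ℝ) * (n + 1)) : ℝ) : ℂ)) (𝓝[>] 0) (𝓝 0) := by
          simpa [Function.comp_def] using (continuous_ofReal.tendsto 0).comp h1
        simp only [hg, hn, if_false]
        simpa using (h2.const_mul ((-1 : ℂ) ^ n)).mul_const (exp (-(2 * (n : ℂ) + 1) * x))
    · filter_upwards [hsmall] with p hp n
      have h1 : p ^ ((n : ℝ) * (n + 1)) ≤ Real.exp (-((n : ℝ) * (n + 1))) := by
        have h0 : (0 : ℝ) ≤ (n : ℝ) * (n + 1) := by exact_mod_cast int_mul_succ_nonneg n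
        have := Real.rpow_le_rpow hp.1.le hp.2.le h0
        rwa [← Real.exp_mul, neg_one_mul] at this
      have h2 : ‖exp (-(2 * (n : ℂ) + 1) * x)‖ ≤ Real.exp (|2 * (n : ℝ) + 1| * ‖x‖) := by
        rw [Complex.norm_exp, Real.exp_le_exp]
        refine (re_le_norm _).trans ?_
        rw [norm_mul, norm_neg]
        have : (2 * (n : ℂ) + 1) = ((2 * (n : ℝ) + 1 : ℝ) : ℂ) := by push_cast; ring
        rw [this, norm_real, Real.norm_eq_abs]
      rw [norm_mul, norm_mul, norm_zpow, norm_neg, norm_one, one_zpow, one_mul, norm_real,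
        Real.norm_of_nonneg (Real.rpow_nonneg hp.1.le _), Real.exp_add]
      exact mul_le_mul h1 h2 (norm_nonneg _) (Real.exp_pos _).le
  have hsum : -(1 / 2) * ∑' n, g n = sinh x := by
    rw [tsum_eq_sum (s := {0, -1}) (fun n hn => by
      simp only [Finset.mem_insert, Finset.mem_singleton] at hn
      simp only [hg, hn, if_false])]
    rw [Finset.sum_pair (by norm_num)]
    simp only [hg, true_or, or_true, if_true, Complex.sinh]
    norm_num
    ring
  rw [← hsum]
  refine (hlim.const_mul _).congr' ?_
  filter_upwards [self_mem_nhdsWithin] with p hp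
  exact (thetaNorm_mul_theta hp x).symm

theorem thetaNorm_ne_zero {p : ℝ} (hp : 0 < p) : thetaNorm p ≠ 0 := by
  refine mul_ne_zero (neg_ne_zero.mpr I_ne_zero) ?_
  exact_mod_cast (Real.rpow_pos_of_pos hp _).ne'

/-- The trigonometric dynamical `R`-matrix. -/
def trigR (γ x τ : ℂ) : Matrix (Fin 2 × Fin 2) (Fin 2 × Fin 2) ℂ :=
  iceMatrix (sinh (x + γ)) (sinh (τ - γ) * sinh x * (sinh τ)⁻¹)
    (sinh (τ - x) * sinh γ * (sinh τ)⁻¹) (sinh (τ + x) * sinh γ * (sinh τ)⁻¹)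
    (sinh (τ + γ) * sinh x * (sinh τ)⁻¹) (sinh (x + γ))

theorem smul_iceMatrix (q a₁ b₁ c₁ c₂ b₂ a₂ : ℂ) :
    q • iceMatrix a₁ b₁ c₁ c₂ b₂ a₂ =
      iceMatrix (q * a₁) (q * b₁) (q * c₁) (q * c₂) (q * b₂) (q * a₂) := by
  ext ⟨u₁, u₂⟩ ⟨v₁, v₂⟩
  fin_cases u₁ <;> fin_cases u₂ <;> fin_cases v₁ <;> fin_cases v₂ <;> simp [iceMatrix]

/-- Every nonzero entry is homogeneous of degree one in theta, so a single factor `thetaNorm p`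
normalises the whole matrix. -/
theorem tendsto_ellipticR (γ x τ : ℂ) (hτ : sinh τ ≠ 0) :
    Tendsto (fun p : ℝ => thetaNorm p • ellipticR p γ x τ) (𝓝[>] 0) (𝓝 (trigR γ x τ)) := by
  have key : ∀ u v : ℂ, Tendsto (fun p : ℝ => thetaNorm p *
      (theta p u * theta p v * (theta p τ)⁻¹)) (𝓝[>] 0) (𝓝 (sinh u * sinh v * (sinh τ)⁻¹)) := by
    intro u v
    refine (((tendsto_theta u).mul (tendsto_theta v)).mul
      ((tendsto_theta τ).inv₀ hτ)).congr' ?_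
    filter_upwards [self_mem_nhdsWithin] with p hp
    have := thetaNorm_ne_zero hp
    rw [mul_inv]
    field_simp
  simp only [ellipticR, smul_iceMatrix]
  exact tendsto_iceMatrix (tendsto_theta _) (key _ _) (key _ _) (key _ _) (key _ _)
    (tendsto_theta _)

/-- The finite dynamical shift u disappears in the limit, which is therefore non-dynamical. -/
theorem tendsto_trigR (γ x u : ℂ) :
    Tendsto (fun τ => trigR γ x (τ + u)) (comap re atTop) (𝓝 (gaugedR γ x)) := by
  have key : ∀ v y : ℂ, Tendsto (fun τ : ℂ => sinh (τ + u + v) * y * (sinh (τ + u))⁻¹)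
      (comap re atTop) (𝓝 (exp v * y)) := by
    intro v y
    have := (tendsto_sinh_add_div_sinh_add (u + v) u).mul_const y
    rw [add_sub_cancel_left] at this
    refine this.congr fun τ => ?_
    rw [add_assoc]
    ring
  simp only [trigR, gaugedR, sub_eq_add_neg (_ + u)]
  exact tendsto_iceMatrix tendsto_const_nhds (key _ _) (key _ _) (key _ _) (key _ _)
    tendsto_const_nhds

/-- The partition function of the trigonometric SOS model. -/
def trigZ (L : ℕ) (γ : ℂ) (μ x : Fin L → ℂ) (τ : ℂ) : ℂ :=
  partitionFunction L (trigR γ) γ μ x τ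

theorem eventually_tendsto_ellipticZ (L : ℕ) (γ : ℂ) (μ x : Fin L → ℂ) :
    ∀ᶠ τ in comap re atTop,
      Tendsto (fun p : ℝ => thetaNorm p ^ (L ^ 2) * ellipticZ L p γ μ x τ) (𝓝[>] (0 : ℝ))
        (𝓝 (trigZ L γ μ x τ)) := by
  -- Only finitely many shifts of τ occur, so all denominators are nonzero once Re τ is large.
  have hne : ∀ᶠ τ : ℂ in comap re atTop, ∀ (j i : Fin L) (v : Fin L → Fin 2),
      sinh (τ + (((j : ℕ) + 1) * γ -
        γ * ∑ k ∈ Finset.univ.filter (fun k => i < k), hWeight (v k))) ≠ 0 :=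
    eventually_all.mpr fun _ => eventually_all.mpr fun _ => eventually_all.mpr fun _ =>
      eventually_sinh_add_ne_zero _
  filter_upwards [hne] with τ hτ
  simp only [ellipticZ, ← partitionFunction_smul]
  refine tendsto_partitionFunction (R := fun p x τ => thetaNorm p • ellipticR p γ x τ)
    (γ := fun _ => γ) (τ := fun _ => τ) fun j i v => tendsto_ellipticR _ _ _ ?_
  rw [add_sub_assoc]
  exact hτ j i v

theorem tendsto_trigZ (L : ℕ) (γ : ℂ) (μ x : Fin L → ℂ) :
    Tendsto (fun τ => exp (∑ j, (x j - μ j)) * trigZ L γ μ x τ) (comap re atTop)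
      (𝓝 (sixVertexZ L γ μ x)) := by
  have h : Tendsto (fun τ => trigZ L γ μ x τ) (comap re atTop)
      (𝓝 (partitionFunction L (fun x _ => gaugedR γ x) γ μ x 0)) := by
    refine tendsto_partitionFunction (R := fun _ => trigR γ) (γ := fun _ => γ)
      (τ := fun τ => τ) fun j i v => ?_
    simp only [add_sub_assoc]
    exact tendsto_trigR _ _ _
  have h' := h.const_mul (exp (∑ j, (x j - μ j)))
  rwa [partitionFunction_gaugedR, ← mul_assoc, ← exp_add, add_neg_cancel, exp_zero, one_mul] at h'

end Limits

end DomainWall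

end

theorem theorem6 (L : ℕ) (γ : ℂ) (μ x : Fin L → ℂ) (x₀ : ℂ)
    (hx : ∀ i j, i ≠ j → DomainWall.wb (x i - x j) ≠ 0)
    (hx₀ : ∀ i, DomainWall.wb (x i - x₀) ≠ 0)
    (hμ : ∀ k, DomainWall.wa γ (x₀ - μ k) ≠ 0) :
    (∃ Ztrig : ℂ → ℂ,
      (∀ᶠ τ in Filter.comap Complex.re Filter.atTop,
        Filter.Tendsto
          (fun p : ℝ => (-Complex.I * ((p ^ (-(1 / 4) : ℝ) : ℝ) : ℂ)) ^ (L ^ 2) *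
            DomainWall.ellipticZ L p γ μ x τ)
          (𝓝[>] (0 : ℝ)) (𝓝 (Ztrig τ))) ∧
      Filter.Tendsto (fun τ : ℂ => Complex.exp (∑ j, (x j - μ j)) * Ztrig τ)
        (Filter.comap Complex.re Filter.atTop) (𝓝 (DomainWall.sixVertexZ L γ μ x))) ∧
    DomainWall.sixVertexZ L γ μ x =
      (DomainWall.matV L γ μ x x₀).det *
        ∏ k, (DomainWall.wb (x k - x₀) / DomainWall.wa γ (x₀ - μ k)) ∧
    ∀ i, DomainWall.sixVertexZ L γ μ (Function.update x i x₀) =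
      (DomainWall.matVi L γ μ x x₀ i).det *
        ∏ k, (DomainWall.wb (x k - x₀) / DomainWall.wa γ (x₀ - μ k)) := by
  have hquot : ∏ k, DomainWall.wa γ (x₀ - μ k) ≠ 0 := Finset.prod_ne_zero_iff.mpr fun k _ => hμ k
  refine ⟨⟨DomainWall.trigZ L γ μ x, DomainWall.eventually_tendsto_ellipticZ L γ μ x,
    DomainWall.tendsto_trigZ L γ μ x⟩, ?_, fun i => ?_⟩
  · rw [Finset.prod_div_distrib, ← mul_div_assoc, eq_div_iff hquot]
    exact DomainWall.sixVertexZ_mul_prod_eq_det γ μ x x₀ hx hx₀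
  · rw [Finset.prod_div_distrib, ← mul_div_assoc, eq_div_iff hquot]
    exact DomainWall.sixVertexZ_update_mul_prod_eq_det γ μ x x₀ hx hx₀ i
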